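/- Let $C$ be a fusion category over $\mathbb{C}$: a semisimple $\mathbb{C}$-linear (abelian) monoidal category with finite-dimensional Hom-spaces, bilinear tensor product, simple unit object $1$ and finitely many isomorphism classes of simple objects, in which every object has a right dual. Let $\{X_i\}_{i\in I}$ be representatives of the isomorphism classes of simple objects, let $0\in I$ be the label with $X_0\cong 1$, and let $i^*$ be the label such that $X_{i^*}$ is a right dual of $X_i$ (it is then also a left dual). For objects $V,W$ let $\mathrm{Adj}(V\dashv W)$ be the set of pairs $(\eta\colon 1\to W\otimes V,\ \varepsilon\colon V\otimes W\to 1)$ satisfying the snake equations. An *even-handed structure* on $C$ is a family of maps $\Psi\colon \mathrm{Adj}(V\dashv W)\to\mathrm{Adj}(W\dashv V)$ with $\Psi^2=\mathrm{id}$, which respects tensor products of adjunctions and fixes the trivial adjunction on $1$, and such that for every morphism $\theta\colon V\to W$ and all right duals $V^*,W^*$ the mate $\theta^\dagger\colon W^*\to V^*$ computed from the given right dualities equals the mate computed from the left dualities assigned by $\Psi$. It is *spherical* if $\varepsilon\circ(f\otimes \mathrm{id})\circ\Psi(\eta)=\Psi(\varepsilon)\circ(\mathrm{id}\otimes f)\circ\eta$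 for every $f\colon V\to V$ and every right dual of $V$, where $\Psi(\eta,\varepsilon)=(\Psi(\eta),\Psi(\varepsilon))$. The *paired dimension* $d_{\{i,i^*\}}\in\mathbb{C}$ is the product $(e\circ\eta)(\varepsilon\circ n)$, for any $(\eta,\varepsilon)\in\mathrm{Adj}(X_i\dashv X_{i^*})$ and $(n,e)\in\mathrm{Adj}(X_{i^*}\dashv X_i)$; it is nonzero and independent of the choices. A *root choice* is a family $d_i\in\mathbb{C}$ with $d_i^2=d_{\{i,i^*\}}$ and $d_{i^*}=d_i$. Given a root choice, $(\eta,\varepsilon)\in\mathrm{Adj}(X_i\dashv W)$ and $(n,e)\in\mathrm{Adj}(W\dashv X_i)$ are *partners* if $e\circ\eta=d_i$. Let $T^i_{jk}\colon\mathrm{Hom}(X_i,X_j\otimes X_k)\to\mathrm{Hom}(X_i,X_j\otimes X_k)$ send $a$ to the morphism obtained by first forming its mate $X_{k^*}\otimes X_{j^*}\to X_{i^*}$ with respect to right dualities of $X_i,X_j,X_k$, and then forming the mate of the result with respect to their partners (regarded as exhibiting $X_i, X_j, X_k$ as right duals of $X_{i^*},X_{j^*},X_{k^*}$); this does not depend on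 the right dualities used. Fix a root choice. Then each $T^i_{jk}$ is an involution, and the following hold. (i) If some $T^i_{jk}$ is neither $\mathrm{id}$ nor $-\mathrm{id}$, then $C$ has no even-handed structure. (ii) Suppose $T^i_{jk}=\epsilon^i_{jk}\,\mathrm{id}$ with $\epsilon^i_{jk}\in\{1,-1\}$ for all $(i,j,k)$ such that $X_i$ appears in $X_j\otimes X_k$. Then there is a canonical bijection between the even-handed structures on $C$ and the $\epsilon$-twisted monoidal natural transformations of the identity, i.e. the families of nonzero scalars $(t_i)_{i\in I}$ with $t_jt_k=\epsilon^i_{jk}t_i$ whenever $X_i$ appears in $X_j\otimes X_k$. It sends $\Psi$ to the family $(t_i)$ determined by $\Psi(\eta,\varepsilon)=(t_i^{-1}n,\ t_i e)$ for all partners $(\eta,\varepsilon)\in\mathrm{Adj}(X_i\dashv W)$, $(n,e)\in\mathrm{Adj}(W\dashv X_i)$. (iii) Suppose in addition to the hypothesis of (ii) that $d_0=1$. Then $\epsilon$ is a collection of pivotal symbols on the Grothendieck ring $[C]$, and $C$ has a spherical even-handed structure if and only if the class $[\epsilon]$ is trivial in $H_{\mathrm{piv}}([C],\mathbb{Z}/2)$.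 Here a collection of pivotal symbols consists of signs $\epsilon^i_{jk}=\pm1$, one for each $(i,j,k)$ such that $X_i$ appears in $X_j\otimes X_k$, with $\epsilon^i_{jk}=\epsilon^{k^*}_{i^*j}$, $\epsilon^i_{jk}=\epsilon^{i^*}_{k^*j^*}$ and $\epsilon^0_{ii^*}=1$, and $H_{\mathrm{piv}}([C],\mathbb{Z}/2)$ is the group of these modulo $\epsilon^i_{jk}\sim f_if_jf_k\,\epsilon^i_{jk}$, where $f\colon I\to\{1,-1\}$ satisfies $f_0=1$ and $f_{i^*}=f_i$. -/

import Mathlib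

open CategoryTheory CategoryTheory.Limits MonoidalCategory

universe w v u

namespace EvenHanded

/-! ### Adjunctions and even-handed structures on a monoidal category -/

section Duals

variable {C : Type u} [Category.{v} C] [MonoidalCategory C]

/-- `Adj V W` is the set of all pairs `(η, ε)` of a unit `η : 𝟙 ⟶ W ⊗ V` and a counit
`ε : V ⊗ W ⟶ 𝟙` exhibiting `W` as a right dual of `V` (equivalently, `V` as a left dual of `W`),
i.e. satisfying the two snake equations. -/
abbrev Adj (V W : C) := ExactPairing W V

namespace Adj

/-- The unit `η : 𝟙 ⟶ W ⊗ V`. -/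
def unit {V W : C} (p : Adj V W) : 𝟙_ C ⟶ W ⊗ V := p.coevaluation'

/-- The counit `ε : V ⊗ W ⟶ 𝟙`. -/
def counit {V W : C} (p : Adj V W) : V ⊗ W ⟶ 𝟙_ C := p.evaluation'

/-- The trivial adjunction on the unit object, given by the unit coherence isomorphism. -/
@[reducible] def trivial (C : Type u) [Category.{v} C] [MonoidalCategory C] : Adj (𝟙_ C) (𝟙_ C) :=
  exactPairingUnit

/-- The composite of two adjunctions: `W' ⊗ V'` is a right dual of `V ⊗ W`, with nested
units and counits. -/
@[reducible] def tensor {V V' W W' : C} (p : Adj V V') (q : Adj W W') : Adj (V ⊗ W) (W' ⊗ V') :=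
  @ExactPairing.tensor C _ _ W' V' W V q p

/-- The right dagger of `θ : V ⟶ W`: the mate of `θ`, computed from right duals `V'` of `V` and
`W'` of `W`. -/
def rightDagger {V V' W W' : C} (p : Adj V V') (q : Adj W W') (θ : V ⟶ W) : W' ⟶ V' :=
  (λ_ W').inv ≫ p.unit ▷ W' ≫ (α_ V' V W').hom ≫ V' ◁ (θ ▷ W') ≫ V' ◁ q.counit ≫ (ρ_ V').hom

/-- The left dagger of `θ : V ⟶ W`: the mate of `θ`, computed from left duals `V'` of `V` and
`W'` of `W`. -/
def leftDagger {V V' W W' : C} (p : Adj V' V) (q : Adj W' W) (θ : V ⟶ W) : W' ⟶ V' :=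
  (ρ_ W').inv ≫ W' ◁ p.unit ≫ W' ◁ (θ ▷ V') ≫ (α_ W' W V').inv ≫ q.counit ▷ V' ≫ (λ_ V').hom

end Adj

/-- An even-handed structure on a monoidal category: a rule turning every presentation of `W` as
a right dual of `V` into a presentation of `W` as a left dual of `V`, which is involutive,
respects tensor products and the unit, and satisfies the even-handed equation: the right dagger
of any morphism agrees with its left dagger computed according to `Ψ`. -/
@[ext]
structure EvenHandedStructure (C : Type u) [Category.{v} C] [MonoidalCategory C] where
  /-- The map from right to left duality structures. -/
  Ψ : ∀ {V W : C}, Adj V W → Adj W V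
  Ψ_Ψ : ∀ {V W : C} (p : Adj V W), Ψ (Ψ p) = p
  Ψ_tensor : ∀ {V V' W W' : C} (p : Adj V V') (q : Adj W W'),
    Ψ (p.tensor q) = (Ψ q).tensor (Ψ p)
  Ψ_trivial : Ψ (Adj.trivial C) = Adj.trivial C
  even_handed : ∀ {V V' W W' : C} (p : Adj V V') (q : Adj W W') (θ : V ⟶ W),
    Adj.rightDagger p q θ = Adj.leftDagger (Ψ p) (Ψ q) θ

namespace EvenHandedStructure

variable (E : EvenHandedStructure C)

/-- The right trace of `f : V ⟶ V`, computed with a right dual `W` of `V`. -/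
def rightTrace {V W : C} (p : Adj V W) (f : V ⟶ V) : 𝟙_ C ⟶ 𝟙_ C :=
  (E.Ψ p).unit ≫ f ▷ W ≫ p.counit

/-- The left trace of `f : V ⟶ V`, computed with a right dual `W` of `V`. -/
def leftTrace {V W : C} (p : Adj V W) (f : V ⟶ V) : 𝟙_ C ⟶ 𝟙_ C :=
  p.unit ≫ W ◁ f ≫ (E.Ψ p).counit

/-- An even-handed structure is spherical if right and left traces always coincide. -/
def IsSpherical : Prop :=
  ∀ (V W : C) (p : Adj V W) (f : V ⟶ V), E.rightTrace p f = E.leftTrace p f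

end EvenHandedStructure

end Duals

/-! ### Fusion categories over `ℂ` -/

attribute [local instance] Abelian.hasFiniteBiproducts

/-- A fusion category over `ℂ`: a semisimple `ℂ`-linear monoidal category with finite-dimensional
spaces of morphisms, with simple unit object and finitely many isomorphism classes of simple
objects, in which every object has a right dual. -/
class IsFusionCategory (C : Type u) [Category.{v} C] [Abelian C] [Linear ℂ C]
    [MonoidalCategory C] [MonoidalPreadditive C] [MonoidalLinear ℂ C] : Prop where
  finiteDimensional_hom : ∀ V W : C, FiniteDimensional ℂ (V ⟶ W)
  semisimple : ∀ V : C, ∃ (n : ℕ) (S : Fin n → C), (∀ a, Simple (S a)) ∧ Nonempty (V ≅ ⨁ S)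
  finitely_many_simples : ∃ (n : ℕ) (S : Fin n → C),
    ∀ V : C, Simple V → ∃ a, Nonempty (V ≅ S a)
  simple_unit : Simple (𝟙_ C)
  exists_right_dual : ∀ V : C, ∃ W : C, Nonempty (Adj V W)

/-- A choice of representatives `X i`, `i : I`, of the isomorphism classes of simple objects. -/
structure SimpleObjects (C : Type u) [Category.{v} C] [Abelian C] (I : Type w) where
  /-- The representative simple objects. -/
  X : I → C
  simple : ∀ i, Simple (X i)
  eq_of_iso : ∀ i j, Nonempty (X i ≅ X j) → i = j
  exists_iso : ∀ V : C, Simple V → ∃ i, Nonempty (V ≅ X i)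

theorem id_eq_zero_of_zigzag {C : Type u} [Category.{v} C] [Preadditive C] [MonoidalCategory C]
    [MonoidalPreadditive C] {V W : C} (p : Adj V W) (h : p.unit = 0 ∨ p.counit = 0) :
    𝟙 V = 0 := by
  have h1 : V ◁ p.unit ≫ (α_ V W V).inv ≫ p.counit ▷ V = (ρ_ V).hom ≫ (λ_ V).inv :=
    p.coevaluation_evaluation'
  have h2 : 𝟙 V = (ρ_ V).inv ≫ ((ρ_ V).hom ≫ (λ_ V).inv) ≫ (λ_ V).hom := by simp
  rw [h2, ← h1]
  rcases h with h | h <;> simp [h]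

section Facts

variable {C : Type u} [Category.{v} C] [Abelian C] [Linear ℂ C]
  [MonoidalCategory C] [MonoidalPreadditive C] [MonoidalLinear ℂ C] [IsFusionCategory C]

attribute [local instance] IsFusionCategory.finiteDimensional_hom IsFusionCategory.simple_unit

theorem exists_section {V S : C} [Simple S] (f : V ⟶ S) (hf : f ≠ 0) :
    ∃ s : S ⟶ V, s ≫ f = 𝟙 S := by
  obtain ⟨n, T, hT, ⟨e⟩⟩ := IsFusionCategory.semisimple V
  have : ∃ a, biproduct.ι T a ≫ e.inv ≫ f ≠ 0 := by
    by_contra! h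
    apply hf
    rw [← cancel_epi e.inv]
    apply biproduct.hom_ext'
    intro a
    simp [h a]
  obtain ⟨a, ha⟩ := this
  have := hT a
  have := (isIso_iff_nonzero (biproduct.ι T a ≫ e.inv ≫ f)).2 ha
  refine ⟨inv (biproduct.ι T a ≫ e.inv ≫ f) ≫ biproduct.ι T a ≫ e.inv, ?_⟩
  have h := IsIso.inv_hom_id (biproduct.ι T a ≫ e.inv ≫ f)
  simpa only [Category.assoc] using h

theorem exists_smul_id {S : C} [Simple S] (f : S ⟶ S) : ∃ c : ℂ, f = c • 𝟙 S := by
  obtain ⟨c, hc⟩ := endomorphism_simple_eq_smul_id ℂ f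
  exact ⟨c, hc.symm⟩

theorem exists_smul_unit {V W : C} [Simple V] (p : Adj V W) (s : 𝟙_ C ⟶ W ⊗ V) :
    ∃ c : ℂ, s = c • p.unit := by
  let _ : ExactPairing W V := p
  obtain ⟨f, rfl⟩ := (tensorLeftHomEquiv (𝟙_ C) W V V).surjective s
  obtain ⟨c, hc⟩ := exists_smul_id ((ρ_ V).inv ≫ f)
  have hf : f = c • (ρ_ V).hom := by
    rw [← cancel_epi (ρ_ V).inv, hc]
    simp
  refine ⟨c, ?_⟩
  subst hf
  have : (λ_ (𝟙_ C)).inv ≫ p.unit ▷ 𝟙_ C ≫ (α_ W V (𝟙_ C)).hom ≫ W ◁ (ρ_ V).hom = p.unit := by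
    monoidal
  rw [← this]
  simp [tensorLeftHomEquiv, Adj.unit, ExactPairing.coevaluation]

theorem unit_ne_zero {V W : C} [Simple V] (p : Adj V W) : p.unit ≠ 0 :=
  fun h => id_nonzero V (id_eq_zero_of_zigzag p (Or.inl h))

theorem counit_ne_zero {V W : C} [Simple V] (p : Adj V W) : p.counit ≠ 0 :=
  fun h => id_nonzero V (id_eq_zero_of_zigzag p (Or.inr h))

theorem simple_right_dual {V W : C} [Simple V] (p : Adj V W) : Simple W := by
  -- every endomorphism of `W` is a scalar
  have hW : ∀ f : W ⟶ W, ∃ c : ℂ, f = c • 𝟙 W := by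
    intro f
    obtain ⟨c, hc⟩ := exists_smul_unit p (p.unit ≫ f ▷ V)
    refine ⟨c, ?_⟩
    have h1 : p.unit ▷ W ≫ (α_ W V W).hom ≫ W ◁ p.counit = (λ_ W).hom ≫ (ρ_ W).inv :=
      p.evaluation_coevaluation'
    have h2 : (λ_ W).inv ≫ (p.unit ≫ f ▷ V) ▷ W ≫ (α_ W V W).hom ≫ W ◁ p.counit ≫ (ρ_ W).hom
        = f := by
      have : (p.unit ≫ f ▷ V) ▷ W ≫ (α_ W V W).hom ≫ W ◁ p.counit
          = (p.unit ▷ W ≫ (α_ W V W).hom ≫ W ◁ p.counit) ≫ f ▷ (𝟙_ C) := by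
        simp only [comp_whiskerRight, Category.assoc, whisker_exchange,
          associator_naturality_left_assoc]
      rw [h1] at this
      have := congrArg (fun g => (λ_ W).inv ≫ g ≫ (ρ_ W).hom) this
      simpa using this
    rw [← h2, hc]
    have := congrArg (fun g => (λ_ W).inv ≫ g ≫ (ρ_ W).hom) h1
    simp at this
    simp [this]
  obtain ⟨n, S, hS, ⟨e⟩⟩ := IsFusionCategory.semisimple W
  have hne : 𝟙 W ≠ 0 := by
    intro h
    apply unit_ne_zero p
    have : p.unit = p.unit ≫ (𝟙 W) ▷ V := by simp
    rw [this, h]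
    simp
  have : ∃ a, biproduct.ι S a ≫ e.inv ≠ 0 := by
    by_contra! h
    apply hne
    rw [← cancel_epi e.inv]
    apply biproduct.hom_ext'
    intro a
    simp [h a]
  obtain ⟨a, ha⟩ := this
  have hSa := hS a
  have hsec : (biproduct.ι S a ≫ e.inv) ≫ (e.hom ≫ biproduct.π S a) = 𝟙 (S a) := by simp
  obtain ⟨c, hc⟩ := hW ((e.hom ≫ biproduct.π S a) ≫ (biproduct.ι S a ≫ e.inv))
  have hc1 : biproduct.ι S a ≫ e.inv = c • (biproduct.ι S a ≫ e.inv) := by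
    have := congrArg (fun g => (biproduct.ι S a ≫ e.inv) ≫ g) hc
    simpa using this
  have hc' : c = 1 := by
    by_contra hcne
    apply ha
    have : (1 - c) • (biproduct.ι S a ≫ e.inv) = 0 := by
      rw [sub_smul, ← hc1]; simp
    exact (smul_eq_zero.1 this).resolve_left (sub_ne_zero.2 (Ne.symm hcne))
  rw [hc', one_smul] at hc
  exact Simple.of_iso (Y := S a) ⟨e.hom ≫ biproduct.π S a, biproduct.ι S a ≫ e.inv, hc, hsec⟩

/-- The right dual of a simple object is also a left dual of it. -/
theorem nonempty_left_adj {V W : C} [Simple V] (p : Adj V W) : Nonempty (Adj W V) := by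
  have hW := simple_right_dual p
  obtain ⟨W', ⟨p'⟩⟩ := IsFusionCategory.exists_right_dual W
  have hW' := simple_right_dual p'
  obtain ⟨s, hs⟩ := exists_section p.counit (counit_ne_zero p)
  let _ : ExactPairing W' W := p'
  obtain ⟨f, hf⟩ := (tensorRightHomEquiv (𝟙_ C) W' W V).surjective s
  have hf0 : (λ_ W').inv ≫ f ≠ 0 := by
    intro h
    have h' : f = 0 := by
      rw [← cancel_epi (λ_ W').inv, h]; simp
    apply id_nonzero (𝟙_ C)
    rw [← hs, ← hf, h']
    simp [tensorRightHomEquiv]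
  have := (isIso_iff_nonzero ((λ_ W').inv ≫ f)).2 hf0
  exact ⟨exactPairingCongrLeft (asIso ((λ_ W').inv ≫ f)).symm⟩

/-- The scalar by which an endomorphism of the unit object acts. -/
noncomputable def unitScalar (f : 𝟙_ C ⟶ 𝟙_ C) : ℂ := (exists_smul_id f).choose

theorem unitScalar_spec (f : 𝟙_ C ⟶ 𝟙_ C) : f = unitScalar f • 𝟙 (𝟙_ C) :=
  (exists_smul_id f).choose_spec

theorem unit_comp_counit_ne_zero {V W : C} [Simple V] (p : Adj V W) (q : Adj W V) :
    p.unit ≫ q.counit ≠ 0 := by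
  have hW := simple_right_dual p
  obtain ⟨s, hs⟩ := exists_section q.counit (counit_ne_zero q)
  obtain ⟨c, rfl⟩ := exists_smul_unit p s
  intro h
  apply id_nonzero (𝟙_ C)
  rw [← hs]
  simp [h]

theorem exists_partner {V W : C} [Simple V] (p : Adj V W) (q : Adj W V) {c : ℂ} (hc : c ≠ 0) :
    ∃ q' : Adj W V, p.unit ≫ q'.counit = c • 𝟙 (𝟙_ C) := by
  obtain ⟨z, hz⟩ := exists_smul_id (p.unit ≫ q.counit)
  have h0 : z ≠ 0 := by
    rintro rfl
    exact unit_comp_counit_ne_zero p q (by rw [hz, zero_smul])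
  let e : V ≅ V :=
    ⟨(c / z) • 𝟙 V, (z / c) • 𝟙 V, by simp [smul_smul, h0, hc], by simp [smul_smul, h0, hc]⟩
  let q' : Adj W V := @exactPairingCongrLeft C _ _ V V W q e
  refine ⟨q', ?_⟩
  have h : q'.counit = (c / z) • q.counit := by
    change W ◁ ((c / z) • 𝟙 V) ≫ q.counit = _
    simp
  rw [h, Linear.comp_smul, hz, smul_smul, div_mul_cancel₀ _ h0]

end Facts

/-! ### Fusion rules and pivotal cohomology -/

/-- The structure constants of a fusion ring: the labels `I` of its distinguished basis, the
coefficients in `[X_j] [X_k] = ∑ i, N i j k • [X_i]`, the label of the unit and the involution on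
labels. Its pivotal cohomology depends on nothing else. -/
structure FusionRules (I : Type w) where
  /-- The coefficient of the basis element `i` in the product of `j` and `k`. -/
  N : I → I → I → ℕ
  /-- The label of the unit. -/
  one : I
  /-- The involution. -/
  star : I → I

namespace FusionRules

variable {I : Type w} (A : FusionRules I)

/-- The triples `(i, j, k)` for which the basis element `i` appears in the product of `j`
and `k`. -/
structure Triple where
  /-- The label appearing in the product. -/
  i : I
  /-- The first factor. -/
  j : I
  /-- The second factor. -/
  k : I
  appears : A.N i j k ≠ 0

/-- The collections of pivotal symbols: signs `ε i j k`, for `i` appearing in the product of `j`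
and `k`, with `ε i j k = ε k* i* j`, `ε i j k = ε i* k* j*` and `ε 1 i i* = 1`. They form a group
under multiplication. -/
def pivotalSymbols : Subgroup (A.Triple → ℤˣ) where
  carrier := {ε |
    (∀ i j k (h : A.N i j k ≠ 0) (h' : A.N (A.star k) (A.star i) j ≠ 0),
      ε ⟨i, j, k, h⟩ = ε ⟨A.star k, A.star i, j, h'⟩) ∧
    (∀ i j k (h : A.N i j k ≠ 0) (h' : A.N (A.star i) (A.star k) (A.star j) ≠ 0),
      ε ⟨i, j, k, h⟩ = ε ⟨A.star i, A.star k, A.star j, h'⟩) ∧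
    (∀ i (h : A.N A.one i (A.star i) ≠ 0), ε ⟨A.one, i, A.star i, h⟩ = 1)}
  one_mem' := ⟨fun _ _ _ _ _ => rfl, fun _ _ _ _ _ => rfl, fun _ _ => rfl⟩
  mul_mem' := by
    rintro x y ⟨hx1, hx2, hx3⟩ ⟨hy1, hy2, hy3⟩
    refine ⟨fun i j k h h' => ?_, fun i j k h h' => ?_, fun i h => ?_⟩
    · rw [Pi.mul_apply, Pi.mul_apply, hx1 i j k h h', hy1 i j k h h']
    · rw [Pi.mul_apply, Pi.mul_apply, hx2 i j k h h', hy2 i j k h h']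
    · rw [Pi.mul_apply, hx3 i h, hy3 i h, one_mul]
  inv_mem' := by
    rintro x ⟨hx1, hx2, hx3⟩
    refine ⟨fun i j k h h' => ?_, fun i j k h h' => ?_, fun i h => ?_⟩
    · rw [Pi.inv_apply, Pi.inv_apply, hx1 i j k h h']
    · rw [Pi.inv_apply, Pi.inv_apply, hx2 i j k h h']
    · rw [Pi.inv_apply, hx3 i h, inv_one]

/-- The collections of pivotal symbols equivalent to the trivial one: those of the form
`f i * f j * f k` for signs `f` with `f 1 = 1` and `f i* = f i`. -/
def trivialSymbols : Subgroup A.pivotalSymbols where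
  carrier := {ε | ∃ f : I → ℤˣ, f A.one = 1 ∧ (∀ i, f (A.star i) = f i) ∧
    ∀ s : A.Triple, ε.1 s = f s.i * f s.j * f s.k}
  one_mem' := ⟨1, rfl, fun _ => rfl, fun _ => rfl⟩
  mul_mem' := by
    rintro x y ⟨f, hf1, hf2, hf3⟩ ⟨g, hg1, hg2, hg3⟩
    refine ⟨f * g, ?_, fun i => ?_, fun s => ?_⟩
    · rw [Pi.mul_apply, hf1, hg1, one_mul]
    · rw [Pi.mul_apply, Pi.mul_apply, hf2, hg2]
    · change x.1 s * y.1 s = _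
      rw [hf3, hg3]
      simp only [Pi.mul_apply]
      ac_rfl
  inv_mem' := by
    rintro x ⟨f, hf1, hf2, hf3⟩
    refine ⟨f⁻¹, ?_, fun i => ?_, fun s => ?_⟩
    · rw [Pi.inv_apply, hf1, inv_one]
    · rw [Pi.inv_apply, Pi.inv_apply, hf2]
    · change (x.1 s)⁻¹ = _
      rw [hf3]
      simp only [Pi.inv_apply, mul_inv]

/-- The pivotal cohomology `H_piv(A, ℤ/2)`: collections of pivotal symbols modulo
`ε' i j k = f i * f j * f k * ε i j k`, where `f` takes signs as values, `f 1 = 1` and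
`f i* = f i`. It is written multiplicatively, so its neutral element is `1`. -/
abbrev HPiv : Type w := A.pivotalSymbols ⧸ A.trivialSymbols

end FusionRules

/-! ### Paired dimensions, root choices and the involution operators -/

namespace SimpleObjects

variable {C : Type u} [Category.{v} C] [Abelian C] [Linear ℂ C]
  [MonoidalCategory C] [MonoidalPreadditive C] [MonoidalLinear ℂ C] [IsFusionCategory C]
  {I : Type w} (S : SimpleObjects C I)

attribute [local instance] SimpleObjects.simple

theorem exists_dual (i : I) : ∃ j, Nonempty (Adj (S.X i) (S.X j)) := by
  obtain ⟨W, ⟨p⟩⟩ := IsFusionCategory.exists_right_dual (S.X i)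
  obtain ⟨j, ⟨e⟩⟩ := S.exists_iso W (simple_right_dual p)
  let _ : ExactPairing W (S.X i) := p
  exact ⟨j, ⟨exactPairingCongrLeft e.symm⟩⟩

/-- The label `i*` of the simple object which is a right dual of `X i`. -/
noncomputable def dual (i : I) : I := (S.exists_dual i).choose

/-- A choice of unit and counit exhibiting `X i*` as a right dual of `X i`. -/
@[reducible] noncomputable def rightAdj (i : I) : Adj (S.X i) (S.X (S.dual i)) :=
  (S.exists_dual i).choose_spec.some

/-- A choice of unit and counit exhibiting `X i*` as a left dual of `X i`. -/
@[reducible] noncomputable def leftAdj (i : I) : Adj (S.X (S.dual i)) (S.X i) :=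
  (nonempty_left_adj (S.rightAdj i)).some

theorem exists_unitIndex : ∃ o, Nonempty (𝟙_ C ≅ S.X o) :=
  S.exists_iso _ IsFusionCategory.simple_unit

/-- The label of the unit object. -/
noncomputable def unitIndex : I := S.exists_unitIndex.choose

/-- The paired dimension of `X i` and `X i*`: the product of the two loops
`𝟙 ⟶ X i* ⊗ X i ⟶ 𝟙` and `𝟙 ⟶ X i ⊗ X i* ⟶ 𝟙` formed from a right duality and a left duality.
It does not depend on the choice of these. -/
noncomputable def pairedDim (i : I) : ℂ :=
  unitScalar ((S.rightAdj i).unit ≫ (S.leftAdj i).counit) *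
    unitScalar ((S.leftAdj i).unit ≫ (S.rightAdj i).counit)

theorem pairedDim_ne_zero (i : I) : S.pairedDim i ≠ 0 := by
  have h := unit_comp_counit_ne_zero (S.rightAdj i) (S.leftAdj i)
  have h' := unit_comp_counit_ne_zero (S.leftAdj i) (S.rightAdj i)
  rw [unitScalar_spec ((S.rightAdj i).unit ≫ (S.leftAdj i).counit)] at h
  rw [unitScalar_spec ((S.leftAdj i).unit ≫ (S.rightAdj i).counit)] at h'
  exact mul_ne_zero (left_ne_zero_of_smul h) (left_ne_zero_of_smul h')

/-- A root choice: a square root `d i` of each paired dimension with `d i* = d i`. -/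
structure RootChoice where
  /-- The roots. -/
  d : I → ℂ
  sq_eq : ∀ i, d i ^ 2 = S.pairedDim i
  d_dual : ∀ i, d (S.dual i) = d i

namespace RootChoice

variable {S} (R : RootChoice S)

theorem ne_zero (i : I) : R.d i ≠ 0 := by
  intro h
  apply S.pairedDim_ne_zero i
  rw [← R.sq_eq, h]
  simp

/-- Let `p` exhibit `W` as a right dual of `X i`, and `q` exhibit `W` as a left dual of `X i`.
They are partners if the loop `𝟙 ⟶ W ⊗ X i ⟶ 𝟙` formed from them equals the chosen root `d i`. -/
def IsPartner {i : I} {W : C} (p : Adj (S.X i) W) (q : Adj W (S.X i)) : Prop :=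
  p.unit ≫ q.counit = R.d i • 𝟙 (𝟙_ C)

theorem exists_isPartner (i : I) : ∃ q, R.IsPartner (S.rightAdj i) q :=
  exists_partner (S.rightAdj i) (S.leftAdj i) (R.ne_zero i)

/-- The partner of the chosen right duality of `X i`. -/
@[reducible] noncomputable def partner (i : I) : Adj (S.X (S.dual i)) (S.X i) := (R.exists_isPartner i).choose

/-- The operator `T i j k` on `Hom(X i, X j ⊗ X k)`: bend all strands of `a` around once, sending
`a` to its right dagger `X k* ⊗ X j* ⟶ X i*` computed with right dualities, and then back to a
morphism `X i ⟶ X j ⊗ X k` using the partner left dualities. It does not depend on the right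
dualities chosen. -/
noncomputable def T (i j k : I) : (S.X i ⟶ S.X j ⊗ S.X k) →ₗ[ℂ] (S.X i ⟶ S.X j ⊗ S.X k) where
  toFun a :=
    Adj.rightDagger ((R.partner k).tensor (R.partner j)) (R.partner i)
      (Adj.rightDagger (S.rightAdj i) ((S.rightAdj j).tensor (S.rightAdj k)) a)
  map_add' a b := by
    simp [Adj.rightDagger, MonoidalPreadditive.add_whiskerRight,
      MonoidalPreadditive.whiskerLeft_add]
  map_smul' c a := by
    simp [Adj.rightDagger]

end RootChoice

/-- The structure constants of the Grothendieck ring of `C` in the basis of simple objects: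
`N i j k` is the multiplicity of `X i` in `X j ⊗ X k`. -/
noncomputable def fusionRules : FusionRules I where
  N i j k := Module.finrank ℂ (S.X i ⟶ S.X j ⊗ S.X k)
  one := S.unitIndex
  star := S.dual

/-- The set of `ε`-twisted monoidal natural transformations of the identity: nonzero scalars `t i`
with `t j * t k = ε i j k * t i` whenever `X i` appears in `X j ⊗ X k`. -/
def TwistedAut (ε : S.fusionRules.Triple → ℤˣ) : Type w :=
  {t : I → ℂˣ // ∀ s : S.fusionRules.Triple,
    (t s.j : ℂ) * t s.k = ((ε s : ℤ) : ℂ) * t s.i}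

end SimpleObjects

end EvenHanded

/-! A morphism between objects with chosen right and left duals has two mates. It is called
`c`-twisted when the right mate is `c` times the left one. Twisted morphisms with a fixed `c` form a
linear space; under composition and tensor product the scalars multiply, mates keep their scalar,
coherence maps, units and counits are 1-twisted, and a nonzero morphism has at most one scalar.
Moreover `T a = c • a` says exactly that `a` is `c`-twisted for the partner dualities
(`isTwisted_iff_T`), so every statement about `ε` becomes bookkeeping of scalars.

`T` is an involution by a trace argument. Moving a morphism cyclically through a right trace, or
through a left trace in the opposite direction, applies `T` to it. Partners have equal loops both
ways round, so left and right traces agree on simple objects, hence on their tensor products, and `T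
(T a)` and `a` have the same pairing with every `b`. By semisimplicity this pairing is nondegenerate
(`doubleDagger_doubleDagger`).

An even-handed structure sends the right duality of `X i` to its partner rescaled by some `t i`.
Even-handedness and compatibility with tensor products make every `a : X i ⟶ X j ⊗ X k` twisted by
`t j * t k / t i`. So `T` is a scalar, hence `1` or `-1`, which gives (i), and `t` is an `ε`-twisted
automorphism. Conversely such a `t` prescribes left dualities of the simple objects for which all
these `a` are 1-twisted. They extend uniquely to all objects along direct sum decompositions
(`exists_isLift`, `IsLift.unique`), and the axioms follow from uniqueness (`evenHandedStructure`).

For (iii), the two loops of `X i` are `t i * d i` and `d i / t i`, so sphericality means `t i ^ 2 =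
1`. Spherical structures are thus sign-valued solutions `t`, that is, trivialisations of `ε`. The
normalisation `d 0 = 1` matches the partner on `X 0` with the trivial adjunction. -/

set_option linter.unusedSectionVars false

namespace EvenHanded

/-! ### Mates under adjunctions, and the calculus of twisted morphisms -/

section Mates

variable {C : Type u} [Category.{v} C] [MonoidalCategory C]

namespace Adj

theorem left_zigzag {V W : C} (p : Adj V W) :
    V ◁ p.unit ≫ (α_ V W V).inv ≫ p.counit ▷ V = (ρ_ V).hom ≫ (λ_ V).inv :=
  p.coevaluation_evaluation'

theorem right_zigzag {V W : C} (p : Adj V W) :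
    p.unit ▷ W ≫ (α_ W V W).hom ≫ W ◁ p.counit = (λ_ W).hom ≫ (ρ_ W).inv :=
  p.evaluation_coevaluation'

theorem left_zigzag' {V W : C} (p : Adj V W) :
    V ◁ p.unit ⊗≫ p.counit ▷ V = ⊗𝟙.hom := by
  convert! p.left_zigzag <;> simp [monoidalComp]

theorem right_zigzag' {V W : C} (p : Adj V W) :
    p.unit ▷ W ⊗≫ W ◁ p.counit = ⊗𝟙.hom := by
  convert! p.right_zigzag <;> simp [monoidalComp]

theorem tensor_counit {V V' W W' : C} (p : Adj V V') (q : Adj W W') :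
    (p.tensor q).counit = 𝟙 _ ⊗≫ V ◁ (q.counit ▷ V') ⊗≫ p.counit := rfl

theorem tensor_unit {V V' W W' : C} (p : Adj V V') (q : Adj W W') :
    (p.tensor q).unit = q.unit ⊗≫ (W' ◁ p.unit) ▷ W ⊗≫ 𝟙 _ := rfl

theorem trivial_counit : (Adj.trivial C).counit = (ρ_ (𝟙_ C)).hom := rfl

theorem trivial_unit : (Adj.trivial C).unit = (ρ_ (𝟙_ C)).inv := rfl

/-- A morphism into the right dual is recovered from its pairing with the counit. -/
theorem eq_of_counit_left {V W Z : C} (p : Adj V W) {g g' : Z ⟶ W}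
    (h : V ◁ g ≫ p.counit = V ◁ g' ≫ p.counit) : g = g' := by
  have key : ∀ g : Z ⟶ W, g = 𝟙 _ ⊗≫ p.unit ▷ Z ⊗≫ W ◁ (V ◁ g ≫ p.counit) ⊗≫ 𝟙 _ := by
    intro g
    calc
      g = 𝟙 _ ⊗≫ (𝟙_ C) ◁ g ⊗≫ (p.unit ▷ W ⊗≫ W ◁ p.counit) ⊗≫ 𝟙 _ := by
        rw [right_zigzag']; monoidal
      _ = 𝟙 _ ⊗≫ ((𝟙_ C) ◁ g ≫ p.unit ▷ W) ⊗≫ W ◁ p.counit ⊗≫ 𝟙 _ := by monoidal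
      _ = _ := by rw [whisker_exchange]; monoidal
  rw [key g, key g', h]

/-- A morphism into the left dual is recovered from its pairing with the counit. -/
theorem eq_of_counit_right {V W Z : C} (p : Adj V W) {g g' : Z ⟶ V}
    (h : g ▷ W ≫ p.counit = g' ▷ W ≫ p.counit) : g = g' := by
  have key : ∀ g : Z ⟶ V, g = 𝟙 _ ⊗≫ Z ◁ p.unit ⊗≫ (g ▷ W ≫ p.counit) ▷ V ⊗≫ 𝟙 _ := by
    intro g
    calc
      g = 𝟙 _ ⊗≫ g ▷ (𝟙_ C) ⊗≫ (V ◁ p.unit ⊗≫ p.counit ▷ V) ⊗≫ 𝟙 _ := by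
        rw [left_zigzag']; monoidal
      _ = 𝟙 _ ⊗≫ (g ▷ (𝟙_ C) ≫ V ◁ p.unit) ⊗≫ p.counit ▷ V ⊗≫ 𝟙 _ := by monoidal
      _ = _ := by rw [← whisker_exchange]; monoidal
  rw [key g, key g', h]

theorem rightDagger_counit {V V' W W' : C} (p : Adj V V') (q : Adj W W') (θ : V ⟶ W) :
    V ◁ rightDagger p q θ ≫ p.counit = θ ▷ W' ≫ q.counit := by
  calc
    _ = 𝟙 _ ⊗≫ V ◁ p.unit ▷ W' ⊗≫ ((V ⊗ V') ◁ (θ ▷ W' ≫ q.counit) ≫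
        p.counit ▷ (𝟙_ C)) ⊗≫ 𝟙 _ := by
      unfold rightDagger; monoidal
    _ = 𝟙 _ ⊗≫ (V ◁ p.unit ⊗≫ p.counit ▷ V) ▷ W' ⊗≫ (θ ▷ W' ≫ q.counit) ⊗≫ 𝟙 _ := by
      rw [whisker_exchange]; monoidal
    _ = _ := by rw [left_zigzag']; monoidal

theorem leftDagger_counit {V V' W W' : C} (p : Adj V' V) (q : Adj W' W) (θ : V ⟶ W) :
    leftDagger p q θ ▷ V ≫ p.counit = W' ◁ θ ≫ q.counit := by
  calc
    _ = 𝟙 _ ⊗≫ W' ◁ p.unit ▷ V ⊗≫ ((W' ◁ θ ≫ q.counit) ▷ (V' ⊗ V) ≫ (𝟙_ C) ◁ p.counit) ⊗≫ 𝟙 _ := by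
      unfold leftDagger; monoidal
    _ = 𝟙 _ ⊗≫ W' ◁ (p.unit ▷ V ⊗≫ V ◁ p.counit) ⊗≫ (W' ◁ θ ≫ q.counit) ⊗≫ 𝟙 _ := by
      rw [← whisker_exchange]; monoidal
    _ = _ := by rw [right_zigzag']; monoidal

theorem rightDagger_eq_iff {V V' W W' : C} (p : Adj V V') (q : Adj W W') (θ : V ⟶ W)
    (g : W' ⟶ V') : rightDagger p q θ = g ↔ V ◁ g ≫ p.counit = θ ▷ W' ≫ q.counit := by
  refine ⟨fun h => h ▸ rightDagger_counit p q θ, fun h => eq_of_counit_left p ?_⟩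
  rw [rightDagger_counit, h]

/-- Mates slide along units whenever they slide along counits. -/
theorem unit_of_counit {V V' W W' : C} {p : Adj V V'} {q : Adj W W'} {θ : V ⟶ W} {g : W' ⟶ V'}
    (h : V ◁ g ≫ p.counit = θ ▷ W' ≫ q.counit) : q.unit ≫ g ▷ W = p.unit ≫ V' ◁ θ := by
  have hg : g = 𝟙 _ ⊗≫ p.unit ▷ W' ⊗≫ V' ◁ (θ ▷ W' ≫ q.counit) ⊗≫ 𝟙 _ := by
    rw [← (rightDagger_eq_iff p q θ g).2 h, rightDagger]; monoidal
  calc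
    _ = 𝟙 _ ⊗≫ (𝟙_ C) ◁ q.unit ⊗≫ p.unit ▷ W' ▷ W ⊗≫ V' ◁ (θ ▷ W' ≫ q.counit) ▷ W ⊗≫ 𝟙 _ := by
      rw [hg]; monoidal
    _ = 𝟙 _ ⊗≫ ((𝟙_ C) ◁ q.unit ≫ p.unit ▷ (W' ⊗ W)) ⊗≫ V' ◁ (θ ▷ W' ≫ q.counit) ▷ W ⊗≫ 𝟙 _ := by
      monoidal
    _ = 𝟙 _ ⊗≫ p.unit ⊗≫ V' ◁ (V ◁ q.unit ≫ θ ▷ (W' ⊗ W)) ⊗≫ V' ◁ q.counit ▷ W ⊗≫ 𝟙 _ := by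
      rw [whisker_exchange]; monoidal
    _ = 𝟙 _ ⊗≫ p.unit ⊗≫ V' ◁ θ ⊗≫ V' ◁ (W ◁ q.unit ⊗≫ q.counit ▷ W) ⊗≫ 𝟙 _ := by
      rw [whisker_exchange]; monoidal
    _ = _ := by rw [left_zigzag']; monoidal

/-- An adjunction is determined by its counit. -/
theorem ext_counit {V W : C} {p q : Adj V W} (h : p.counit = q.counit) : p = q := by
  have hu : q.unit = p.unit := by
    have := unit_of_counit (p := p) (q := q) (θ := 𝟙 V) (g := 𝟙 W) (by simp [h])
    simpa using this
  cases p; cases q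
  simp only [unit, counit] at hu h
  subst hu h
  rfl

/-- A morphism out of `V` is recovered from its pairing with the unit. -/
theorem eq_of_unit_left {V W Z : C} (p : Adj V W) {f f' : V ⟶ Z}
    (h : p.unit ≫ W ◁ f = p.unit ≫ W ◁ f') : f = f' := by
  have key : ∀ f : V ⟶ Z, f = 𝟙 _ ⊗≫ V ◁ (p.unit ≫ W ◁ f) ⊗≫ p.counit ▷ Z ⊗≫ 𝟙 _ := by
    intro f
    calc
      f = 𝟙 _ ⊗≫ (V ◁ p.unit ⊗≫ p.counit ▷ V) ⊗≫ (𝟙_ C) ◁ f ⊗≫ 𝟙 _ := by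
        rw [left_zigzag']; monoidal
      _ = 𝟙 _ ⊗≫ V ◁ p.unit ⊗≫ (p.counit ▷ V ≫ (𝟙_ C) ◁ f) ⊗≫ 𝟙 _ := by monoidal
      _ = _ := by rw [← whisker_exchange]; monoidal
  rw [key f, key f', h]

theorem eq_of_rightDagger_eq {V V' W W' : C} (p : Adj V V') (q : Adj W W') {θ θ' : V ⟶ W}
    (h : rightDagger p q θ = rightDagger p q θ') : θ = θ' := by
  apply p.eq_of_unit_left
  rw [← unit_of_counit (rightDagger_counit p q θ), h, unit_of_counit (rightDagger_counit p q θ')]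

end Adj

variable [Preadditive C] [Linear ℂ C]

/-- Let `p`, `q` exhibit `W` as a right and a left dual of `V`, and `p'`, `q'` exhibit `W'` as a
right and a left dual of `V'`. The morphism `θ : V ⟶ V'` is `c`-twisted if its right dagger is `c`
times its left dagger. -/
def IsTwisted {V W V' W' : C} (p : Adj V W) (q : Adj W V) (p' : Adj V' W') (q' : Adj W' V')
    (c : ℂ) (θ : V ⟶ V') : Prop :=
  ∃ g : W' ⟶ W, V ◁ g ≫ p.counit = θ ▷ W' ≫ p'.counit ∧
    g ▷ V ≫ q.counit = c • (W' ◁ θ ≫ q'.counit)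

namespace IsTwisted

theorem id {V W : C} (p : Adj V W) (q : Adj W V) : IsTwisted p q p q 1 (𝟙 V) :=
  ⟨𝟙 _, by simp, by simp⟩

theorem comp {V W V' W' V'' W'' : C} {p : Adj V W} {q : Adj W V} {p' : Adj V' W'} {q' : Adj W' V'}
    {p'' : Adj V'' W''} {q'' : Adj W'' V''} {c c' : ℂ} {θ : V ⟶ V'} {θ' : V' ⟶ V''}
    (h : IsTwisted p q p' q' c θ) (h' : IsTwisted p' q' p'' q'' c' θ') :
    IsTwisted p q p'' q'' (c * c') (θ ≫ θ') := by
  obtain ⟨g, h1, h2⟩ := h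
  obtain ⟨g', h1', h2'⟩ := h'
  refine ⟨g' ≫ g, ?_, ?_⟩
  · rw [MonoidalCategory.whiskerLeft_comp, Category.assoc, h1, whisker_exchange_assoc, h1',
      comp_whiskerRight, Category.assoc]
  · rw [comp_whiskerRight, Category.assoc, h2, Linear.comp_smul, ← whisker_exchange_assoc, h2',
      Linear.comp_smul, smul_smul, MonoidalCategory.whiskerLeft_comp, Category.assoc]

variable [MonoidalPreadditive C] [MonoidalLinear ℂ C]

section

variable {V W V' W' V'' W'' : C} {p : Adj V W} {q : Adj W V} {p' : Adj V' W'} {q' : Adj W' V'}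
    {p'' : Adj V'' W''} {q'' : Adj W'' V''} {c c' : ℂ}

theorem comp_one {θ : V ⟶ V'} {θ' : V' ⟶ V''}
    (h : IsTwisted p q p' q' c θ) (h' : IsTwisted p' q' p'' q'' 1 θ') :
    IsTwisted p q p'' q'' c (θ ≫ θ') := by
  simpa using h.comp h'

theorem one_comp {θ : V ⟶ V'} {θ' : V' ⟶ V''}
    (h : IsTwisted p q p' q' 1 θ) (h' : IsTwisted p' q' p'' q'' c θ') :
    IsTwisted p q p'' q'' c (θ ≫ θ') := by
  simpa using h.comp h'

theorem zero : IsTwisted p q p' q' c (0 : V ⟶ V') :=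
  ⟨0, by simp, by simp⟩

theorem add {θ θ' : V ⟶ V'} (h : IsTwisted p q p' q' c θ) (h' : IsTwisted p q p' q' c θ') :
    IsTwisted p q p' q' c (θ + θ') := by
  obtain ⟨g, h1, h2⟩ := h
  obtain ⟨g', h1', h2'⟩ := h'
  refine ⟨g + g', ?_, ?_⟩ <;>
  simp [MonoidalPreadditive.add_whiskerRight, MonoidalPreadditive.whiskerLeft_add, h1, h2, h1', h2']

theorem smul {θ : V ⟶ V'} (h : IsTwisted p q p' q' c θ) (z : ℂ) :
    IsTwisted p q p' q' c (z • θ) := by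
  obtain ⟨g, h1, h2⟩ := h
  exact ⟨z • g, by simp [h1], by simp [h2, smul_comm z c]⟩

theorem sum {ι : Type*} (s : Finset ι) {θ : ι → (V ⟶ V')}
    (h : ∀ a ∈ s, IsTwisted p q p' q' c (θ a)) : IsTwisted p q p' q' c (∑ a ∈ s, θ a) := by
  classical
  induction s using Finset.induction_on with
  | empty => simpa using zero
  | insert a s ha ih =>
    rw [Finset.sum_insert ha]
    exact (h a (by simp)).add (ih fun b hb => h b (by simp [hb]))

end

end IsTwisted

variable [MonoidalPreadditive C] [MonoidalLinear ℂ C]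

theorem isTwisted_iff {V W V' W' : C} (p : Adj V W) (q : Adj W V) (p' : Adj V' W') (q' : Adj W' V')
    (c : ℂ) (θ : V ⟶ V') :
    IsTwisted p q p' q' c θ ↔ Adj.rightDagger p p' θ = c • Adj.leftDagger q q' θ := by
  constructor
  · rintro ⟨g, h1, h2⟩
    rw [(Adj.rightDagger_eq_iff _ _ _ _).2 h1]
    apply q.eq_of_counit_right
    rw [h2, MonoidalLinear.smul_whiskerRight, Linear.smul_comp, Adj.leftDagger_counit]
  · intro h
    refine ⟨_, Adj.rightDagger_counit _ _ _, ?_⟩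
    rw [h, MonoidalLinear.smul_whiskerRight, Linear.smul_comp, Adj.leftDagger_counit]

namespace IsTwisted

section

variable {V W V' W' V'' W'' : C} {p : Adj V W} {q : Adj W V} {p' : Adj V' W'} {q' : Adj W' V'}
    {p'' : Adj V'' W''} {q'' : Adj W'' V''} {c c' : ℂ}

/-- The mate of a twisted morphism is twisted by the same scalar. -/
theorem mate {θ : V ⟶ V'} (h : IsTwisted p q p' q' c θ) :
    IsTwisted q' p' q p c (Adj.rightDagger p p' θ) := by
  rw [isTwisted_iff] at h
  refine ⟨c • θ, ?_, ?_⟩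
  · rw [h, MonoidalLinear.smul_whiskerRight, Linear.smul_comp, Adj.leftDagger_counit]
    simp
  · rw [Adj.rightDagger_counit]
    simp

/-- Two different scalars would kill the left mate, hence the right mate, and taking mates is
injective. This is what allows scalars to be computed by exhibiting a single nonzero morphism. -/
theorem unique {θ : V ⟶ V'} (h : IsTwisted p q p' q' c θ) (h' : IsTwisted p q p' q' c' θ)
    (hθ : θ ≠ 0) : c = c' := by
  rw [isTwisted_iff] at h h'
  by_contra hc
  apply hθ
  have h0 : Adj.leftDagger q q' θ = 0 := by
    have : (c - c') • Adj.leftDagger q q' θ = 0 := by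
      rw [sub_smul, ← h, ← h', sub_self]
    exact (smul_eq_zero.1 this).resolve_left (sub_ne_zero.2 hc)
  rw [h0, smul_zero] at h
  apply Adj.eq_of_rightDagger_eq p p'
  rw [h, eq_comm, Adj.rightDagger_eq_iff]
  simp

/-- The extra strand is closed off by its own counit, which slides past `g`. Hence `g ▷ Z` is a mate
on both sides with the same scalar. -/
theorem whiskerLeft {θ : V ⟶ V'} (h : IsTwisted p q p' q' c θ) {U Z : C} (r : Adj U Z)
    (s : Adj Z U) :
    IsTwisted (r.tensor p) (q.tensor s) (r.tensor p') (q'.tensor s) c (U ◁ θ) := by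
  obtain ⟨g, h1, h2⟩ := h
  refine ⟨g ▷ Z, ?_, ?_⟩
  · simp only [Adj.tensor_counit]
    calc
      _ = 𝟙 _ ⊗≫ U ◁ (V ◁ g ≫ p.counit) ▷ Z ⊗≫ r.counit := by monoidal
      _ = _ := by rw [h1]; monoidal
  · simp only [Adj.tensor_counit]
    calc
      _ = 𝟙 _ ⊗≫ (g ▷ (Z ⊗ U) ≫ W ◁ s.counit) ▷ V ⊗≫ q.counit := by monoidal
      _ = 𝟙 _ ⊗≫ W' ◁ s.counit ▷ V ⊗≫ (g ▷ V ≫ q.counit) := by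
        rw [← whisker_exchange]; monoidal
      _ = c • (𝟙 _ ⊗≫ W' ◁ (s.counit ▷ V ≫ (𝟙_ C) ◁ θ) ⊗≫ q'.counit) := by
        rw [h2]
        simp only [monoidalComp, Linear.comp_smul]
        congr 1
        monoidal
      _ = _ := by
        rw [← whisker_exchange]
        congr 1
        monoidal

theorem whiskerRight {θ : V ⟶ V'} (h : IsTwisted p q p' q' c θ) {U Z : C} (r : Adj U Z)
    (s : Adj Z U) :
    IsTwisted (p.tensor r) (s.tensor q) (p'.tensor r) (s.tensor q') c (θ ▷ U) := by
  obtain ⟨g, h1, h2⟩ := h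
  refine ⟨Z ◁ g, ?_, ?_⟩
  · simp only [Adj.tensor_counit]
    calc
      _ = 𝟙 _ ⊗≫ V ◁ ((U ⊗ Z) ◁ g ≫ r.counit ▷ W) ⊗≫ p.counit := by monoidal
      _ = 𝟙 _ ⊗≫ V ◁ r.counit ▷ W' ⊗≫ (V ◁ g ≫ p.counit) := by
        rw [whisker_exchange]; monoidal
      _ = 𝟙 _ ⊗≫ (V ◁ r.counit ≫ θ ▷ (𝟙_ C)) ▷ W' ⊗≫ p'.counit := by
        rw [h1]; monoidal
      _ = _ := by rw [whisker_exchange]; monoidal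
  · simp only [Adj.tensor_counit]
    calc
      _ = 𝟙 _ ⊗≫ Z ◁ (g ▷ V ≫ q.counit) ▷ U ⊗≫ s.counit := by monoidal
      _ = _ := by
        rw [h2]
        simp only [monoidalComp, Linear.comp_smul, Linear.smul_comp, MonoidalLinear.whiskerLeft_smul,
          MonoidalLinear.smul_whiskerRight]
        congr 1
        monoidal

theorem tensorHom {U Z U' Z' : C} {r : Adj U Z} {s : Adj Z U} {r' : Adj U' Z'} {s' : Adj Z' U'}
    {θ : V ⟶ V'} {θ' : U ⟶ U'} (h : IsTwisted p q p' q' c θ) (h' : IsTwisted r s r' s' c' θ') :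
    IsTwisted (p.tensor r) (s.tensor q) (p'.tensor r') (s'.tensor q') (c * c') (θ ⊗ₘ θ') := by
  rw [MonoidalCategory.tensorHom_def]
  exact (h.whiskerRight r s).comp (h'.whiskerLeft p' q')

end

section Coherence

variable {V W V' W' V'' W'' : C} (p : Adj V W) (q : Adj W V) (p' : Adj V' W') (q' : Adj W' V')
    (p'' : Adj V'' W'') (q'' : Adj W'' V'')

theorem associator :
    IsTwisted ((p.tensor p').tensor p'') (q''.tensor (q'.tensor q)) (p.tensor (p'.tensor p''))
      ((q''.tensor q').tensor q) 1 (α_ V V' V'').hom := by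
  refine ⟨(α_ _ _ _).hom, ?_, ?_⟩ <;>
  simp only [Adj.tensor_counit, one_smul] <;>
  monoidal

theorem leftUnitor :
    IsTwisted ((Adj.trivial C).tensor p) (q.tensor (Adj.trivial C)) p q 1 (λ_ V).hom := by
  refine ⟨(ρ_ _).inv, ?_, ?_⟩ <;>
  simp only [Adj.tensor_counit, one_smul, Adj.trivial_counit] <;>
  monoidal

theorem leftUnitor_inv :
    IsTwisted p q ((Adj.trivial C).tensor p) (q.tensor (Adj.trivial C)) 1 (λ_ V).inv := by
  refine ⟨(ρ_ _).hom, ?_, ?_⟩ <;>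
  simp only [Adj.tensor_counit, one_smul, Adj.trivial_counit] <;>
  monoidal

theorem rightUnitor :
    IsTwisted (p.tensor (Adj.trivial C)) ((Adj.trivial C).tensor q) p q 1 (ρ_ V).hom := by
  refine ⟨(λ_ _).inv, ?_, ?_⟩ <;>
  simp only [Adj.tensor_counit, one_smul, Adj.trivial_counit] <;>
  monoidal

/-- One snake equation of `q` straightens the right-hand side, leaving only the counit of `p`.
Together with its mirror image below, this identifies the counit of `p` as both mates of the unit of
`q`. -/
theorem unit_zigzag_right :
    (𝟙_ C) ◁ p.counit ≫ (Adj.trivial C).counit =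
      q.unit ▷ (V ⊗ W) ≫ (p.tensor q).counit := by
  symm
  simp only [Adj.tensor_counit, Adj.trivial_counit]
  calc
    _ = 𝟙 _ ⊗≫ (q.unit ▷ V ⊗≫ V ◁ q.counit) ▷ W ⊗≫ p.counit := by monoidal
    _ = _ := by rw [Adj.right_zigzag']; monoidal

theorem unit_zigzag_left :
    p.counit ▷ (𝟙_ C) ≫ (Adj.trivial C).counit = (V ⊗ W) ◁ q.unit ≫ (p.tensor q).counit := by
  symm
  simp only [Adj.tensor_counit, Adj.trivial_counit]
  calc
    _ = 𝟙 _ ⊗≫ V ◁ (W ◁ q.unit ⊗≫ q.counit ▷ W) ⊗≫ p.counit := by monoidal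
    _ = _ := by rw [Adj.left_zigzag']; monoidal

/-- The unit of a left duality is untwisted. -/
theorem unit :
    IsTwisted (Adj.trivial C) (Adj.trivial C) (p.tensor q) (p.tensor q) 1 q.unit :=
  ⟨p.counit, unit_zigzag_right p q, by rw [one_smul]; exact unit_zigzag_left p q⟩

/-- The counit of a right duality is untwisted. -/
theorem counit :
    IsTwisted (p.tensor q) (p.tensor q) (Adj.trivial C) (Adj.trivial C) 1 p.counit := by
  have h := (unit p q).mate
  rwa [(Adj.rightDagger_eq_iff _ _ _ _).2 (unit_zigzag_right p q)] at h

end Coherence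

end IsTwisted

end Mates

end EvenHanded

namespace EvenHanded

/-! ### Left and right traces, the double dagger, and rescaled adjunctions -/

section Traces

variable {C : Type u} [Category.{v} C] [MonoidalCategory C]

namespace Adj

/-- A morphism out of `W` is recovered from its pairing with the unit. -/
theorem eq_of_unit_right {V W Z : C} (p : Adj V W) {f f' : W ⟶ Z}
    (h : p.unit ≫ f ▷ V = p.unit ≫ f' ▷ V) : f = f' := by
  have key : ∀ f : W ⟶ Z, f = 𝟙 _ ⊗≫ (p.unit ≫ f ▷ V) ▷ W ⊗≫ Z ◁ p.counit ⊗≫ 𝟙 _ := by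
    intro f
    calc
      f = 𝟙 _ ⊗≫ (p.unit ▷ W ⊗≫ W ◁ p.counit) ⊗≫ f ▷ (𝟙_ C) ⊗≫ 𝟙 _ := by
        rw [right_zigzag']; monoidal
      _ = 𝟙 _ ⊗≫ p.unit ▷ W ⊗≫ (W ◁ p.counit ≫ f ▷ (𝟙_ C)) ⊗≫ 𝟙 _ := by monoidal
      _ = _ := by rw [whisker_exchange]; monoidal
  rw [key f, key f', h]

/-- An adjunction is determined by its unit. -/
theorem ext_unit {V W : C} {p q : Adj V W} (h : p.unit = q.unit) : p = q := by
  apply ext_counit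
  have h1 := rightDagger_counit p q (𝟙 V)
  have h2 := unit_of_counit h1
  have h3 : rightDagger p q (𝟙 V) = 𝟙 W := by
    apply p.eq_of_unit_right
    rw [h, h2]
    simp [h]
  rw [h3] at h1
  simpa using h1

/-- The left trace of `f`, computed with a right and a left duality. -/
def leftTr {V W : C} (p : Adj V W) (q : Adj W V) (f : V ⟶ V) : 𝟙_ C ⟶ 𝟙_ C :=
  p.unit ≫ W ◁ f ≫ q.counit

/-- The right trace of `f`, computed with a right and a left duality. -/
def rightTr {V W : C} (p : Adj V W) (q : Adj W V) (f : V ⟶ V) : 𝟙_ C ⟶ 𝟙_ C :=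
  q.unit ≫ f ▷ W ≫ p.counit

@[simp]
theorem leftTr_id {V W : C} (p : Adj V W) (q : Adj W V) :
    leftTr p q (𝟙 V) = p.unit ≫ q.counit := by
  simp [leftTr]

@[simp]
theorem rightTr_id {V W : C} (p : Adj V W) (q : Adj W V) :
    rightTr p q (𝟙 V) = q.unit ≫ p.counit := by
  simp [rightTr]

/-- If left and right traces agree on two objects, then they agree on their tensor product. -/
theorem leftTr_tensor_eq_rightTr {V W V' W' : C} {p : Adj V W} {q : Adj W V} {p' : Adj V' W'}
    {q' : Adj W' V'} (h : ∀ f, leftTr p q f = rightTr p q f)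
    (h' : ∀ f, leftTr p' q' f = rightTr p' q' f) (f : V ⊗ V' ⟶ V ⊗ V') :
    leftTr (p.tensor p') (q'.tensor q) f = rightTr (p.tensor p') (q'.tensor q) f := by
  -- The partial traces of `f`: closing the strand `V` on the left, and closing the strand `V'` on
  -- the right. Passing from one to the other only needs the interchange of two disjoint loops.
  let fL : V' ⟶ V' := 𝟙 _ ⊗≫ p.unit ▷ V' ⊗≫ W ◁ f ⊗≫ q.counit ▷ V' ⊗≫ 𝟙 _
  let fR : V ⟶ V := 𝟙 _ ⊗≫ V ◁ q'.unit ⊗≫ f ▷ W' ⊗≫ V ◁ p'.counit ⊗≫ 𝟙 _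
  calc
    _ = leftTr p' q' fL := by
      simp only [leftTr, tensor_unit, tensor_counit, fL]
      monoidal
    _ = rightTr p' q' fL := h' fL
    _ = 𝟙 _ ⊗≫ ((𝟙_ C) ◁ q'.unit ≫ p.unit ▷ (V' ⊗ W')) ⊗≫ W ◁ f ▷ W' ⊗≫
          (q.counit ▷ (V' ⊗ W') ≫ (𝟙_ C) ◁ p'.counit) ⊗≫ 𝟙 _ := by
      simp only [rightTr, fL]
      monoidal
    _ = 𝟙 _ ⊗≫ (p.unit ▷ (𝟙_ C) ≫ (W ⊗ V) ◁ q'.unit) ⊗≫ W ◁ f ▷ W' ⊗≫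
          ((W ⊗ V) ◁ p'.counit ≫ q.counit ▷ (𝟙_ C)) ⊗≫ 𝟙 _ := by
      rw [← whisker_exchange, ← whisker_exchange]
    _ = leftTr p q fR := by
      simp only [leftTr, fR]
      monoidal
    _ = rightTr p q fR := h fR
    _ = _ := by
      simp only [rightTr, tensor_unit, tensor_counit, fR]
      monoidal

/-- Applying the right dagger twice, first with right dualities and then with left dualities. -/
def doubleDagger {V W V' W' : C} (p : Adj V W) (q : Adj W V) (p' : Adj V' W') (q' : Adj W' V')
    (a : V ⟶ V') : V ⟶ V' :=
  rightDagger q' q (rightDagger p p' a)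

section

variable {V W V' W' : C} (p : Adj V W) (q : Adj W V) (p' : Adj V' W') (q' : Adj W' V')

/-- Slide `a` over the counit as its mate, then slide the mate over the unit: `a` comes back on the
other side of `b` as its double dagger. The left trace in the next lemma behaves the same way with
the direction reversed. -/
theorem rightTr_comp_eq (a : V ⟶ V') (b : V' ⟶ V) :
    rightTr p' q' (b ≫ a) = rightTr p q (doubleDagger p q p' q' a ≫ b) := by
  have h := unit_of_counit (rightDagger_counit q' q (rightDagger p p' a))
  simp only [rightTr, doubleDagger, comp_whiskerRight, Category.assoc]
  rw [← rightDagger_counit p p' a, ← whisker_exchange_assoc, ← reassoc_of% h]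

theorem leftTr_comp_doubleDagger (a : V ⟶ V') (b : V' ⟶ V) :
    leftTr p' q' (b ≫ doubleDagger p q p' q' a) = leftTr p q (a ≫ b) := by
  have h := rightDagger_counit q' q (rightDagger p p' a)
  have h' := unit_of_counit (rightDagger_counit p p' a)
  simp only [leftTr, doubleDagger, MonoidalCategory.whiskerLeft_comp, Category.assoc]
  rw [h, whisker_exchange_assoc, reassoc_of% h']

end

end Adj

variable [Preadditive C] [Linear ℂ C] [MonoidalPreadditive C] [MonoidalLinear ℂ C]

/-- The second dagger inverts the left dagger, so being twisted is an eigenvector condition for the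
double dagger. The operator `T` is an instance of the latter. -/
theorem isTwisted_iff_doubleDagger {V W V' W' : C} (p : Adj V W) (q : Adj W V) (p' : Adj V' W')
    (q' : Adj W' V') (c : ℂ) (θ : V ⟶ V') :
    IsTwisted p q p' q' c θ ↔ Adj.doubleDagger p q p' q' θ = c • θ := by
  rw [isTwisted_iff, Adj.doubleDagger,
    Adj.rightDagger_eq_iff q' q (Adj.rightDagger p p' θ) (c • θ)]
  constructor
  · intro h
    rw [h, MonoidalLinear.smul_whiskerRight, Linear.smul_comp, Adj.leftDagger_counit]
    simp
  · intro h
    apply q.eq_of_counit_right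
    rw [← h, MonoidalLinear.smul_whiskerRight, Linear.smul_comp, Adj.leftDagger_counit]
    simp

namespace IsTwisted

variable {V W V' W' : C} {p : Adj V W} {q : Adj W V} {p' : Adj V' W'} {q' : Adj W' V'}
  {c : ℂ} {θ : V ⟶ V'}

/-- Cyclicity of the traces holds up to the twisting scalar, which enters the right and left traces
inversely. Comparing loops therefore determines the scalar. -/
theorem rightTr_comp (h : IsTwisted p q p' q' c θ) (b : V' ⟶ V) :
    Adj.rightTr p' q' (b ≫ θ) = c • Adj.rightTr p q (θ ≫ b) := by
  rw [Adj.rightTr_comp_eq p q, (isTwisted_iff_doubleDagger _ _ _ _ _ _).1 h]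
  simp [Adj.rightTr]

theorem leftTr_comp (h : IsTwisted p q p' q' c θ) (b : V' ⟶ V) :
    c • Adj.leftTr p' q' (b ≫ θ) = Adj.leftTr p q (θ ≫ b) := by
  rw [← Adj.leftTr_comp_doubleDagger p q p' q', (isTwisted_iff_doubleDagger _ _ _ _ _ _).1 h]
  simp [Adj.leftTr]

end IsTwisted

namespace Adj

/-- The adjunction with the unit divided and the counit multiplied by a scalar. -/
@[reducible] def scale {V W : C} (p : Adj V W) (t : ℂˣ) : Adj V W where
  coevaluation' := ((t⁻¹ : ℂˣ) : ℂ) • p.unit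
  evaluation' := (t : ℂ) • p.counit
  coevaluation_evaluation' := by
    simp only [MonoidalLinear.whiskerLeft_smul, MonoidalLinear.smul_whiskerRight, Linear.smul_comp,
      Linear.comp_smul, smul_smul, p.left_zigzag]
    simp
  evaluation_coevaluation' := by
    simp only [MonoidalLinear.whiskerLeft_smul, MonoidalLinear.smul_whiskerRight, Linear.smul_comp,
      Linear.comp_smul, smul_smul, p.right_zigzag]
    simp

theorem scale_unit {V W : C} (p : Adj V W) (t : ℂˣ) :
    (p.scale t).unit = ((t⁻¹ : ℂˣ) : ℂ) • p.unit := rfl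

theorem scale_counit {V W : C} (p : Adj V W) (t : ℂˣ) :
    (p.scale t).counit = (t : ℂ) • p.counit := rfl

theorem scale_scale {V W : C} (p : Adj V W) (s t : ℂˣ) :
    (p.scale s).scale t = p.scale (s * t) := by
  apply ext_counit
  simp only [scale_counit, smul_smul, Units.val_mul]
  rw [mul_comm]

theorem scale_one {V W : C} (p : Adj V W) : p.scale 1 = p := by
  apply ext_counit
  simp [scale_counit]

theorem tensor_scale {V W V' W' : C} (p : Adj V W) (p' : Adj V' W') (s t : ℂˣ) :
    (p.scale s).tensor (p'.scale t) = (p.tensor p').scale (s * t) := by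
  apply ext_counit
  simp only [scale_counit, tensor_counit, monoidalComp, MonoidalLinear.whiskerLeft_smul,
    MonoidalLinear.smul_whiskerRight, Linear.smul_comp, Linear.comp_smul, smul_smul, Units.val_mul]

end Adj

theorem IsTwisted.scale {V W V' W' : C} {p : Adj V W} {q : Adj W V} {p' : Adj V' W'}
    {q' : Adj W' V'} {c c' : ℂ} {θ : V ⟶ V'} (h : IsTwisted p q p' q' c θ) (t t' : ℂˣ)
    (hc : t * c = c' * t') : IsTwisted p (q.scale t) p' (q'.scale t') c' θ := by
  obtain ⟨g, h1, h2⟩ := h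
  refine ⟨g, h1, ?_⟩
  simp only [Adj.scale_counit, Linear.comp_smul, h2, smul_smul, hc]

end Traces

/-! ### Dualities of simple objects, partners, and the involution `T` -/

section Fusion

variable {C : Type u} [Category.{v} C] [Abelian C] [Linear ℂ C]
  [MonoidalCategory C] [MonoidalPreadditive C] [MonoidalLinear ℂ C] [IsFusionCategory C]

attribute [local instance] Abelian.hasFiniteBiproducts
attribute [local instance] IsFusionCategory.finiteDimensional_hom IsFusionCategory.simple_unit

theorem exists_retraction {V S : C} [Simple S] (f : S ⟶ V) (hf : f ≠ 0) :
    ∃ r : V ⟶ S, f ≫ r = 𝟙 S := by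
  obtain ⟨n, T, hT, ⟨e⟩⟩ := IsFusionCategory.semisimple V
  have : ∃ a, f ≫ e.hom ≫ biproduct.π T a ≠ 0 := by
    by_contra! h
    apply hf
    rw [← cancel_mono e.hom]
    apply biproduct.hom_ext
    intro a
    simpa using h a
  obtain ⟨a, ha⟩ := this
  have := hT a
  have := (isIso_iff_nonzero (f ≫ e.hom ≫ biproduct.π T a)).2 ha
  refine ⟨(e.hom ≫ biproduct.π T a) ≫ inv (f ≫ e.hom ≫ biproduct.π T a), ?_⟩
  have h := IsIso.hom_inv_id (f ≫ e.hom ≫ biproduct.π T a)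
  simpa only [Category.assoc] using h

theorem smul_id_unit_injective {a b : ℂ} (h : a • 𝟙 (𝟙_ C) = b • 𝟙 (𝟙_ C)) : a = b := by
  have : (a - b) • 𝟙 (𝟙_ C) = 0 := by rw [sub_smul, h, sub_self]
  exact sub_eq_zero.1 ((smul_eq_zero.1 this).resolve_right (id_nonzero _))

/-- Two adjunctions between the same simple objects differ by a scalar. -/
theorem exists_eq_scale {V W : C} [Simple V] (p p' : Adj V W) : ∃ t : ℂˣ, p' = p.scale t := by
  obtain ⟨c, hc⟩ := exists_smul_unit p p'.unit
  have hc0 : c ≠ 0 := by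
    rintro rfl
    exact unit_ne_zero p' (by rw [hc, zero_smul])
  refine ⟨(Units.mk0 c hc0)⁻¹, Adj.ext_unit ?_⟩
  rw [hc, Adj.scale_unit]
  simp

/-- The two daggers of an isomorphism of simple objects are proportional. -/
theorem exists_isTwisted_of_isIso {V W V' W' : C} [Simple V] (p : Adj V W) (q : Adj W V)
    (p' : Adj V' W') (q' : Adj W' V') (θ : V ⟶ V') [IsIso θ] :
    ∃ c : ℂ, IsTwisted p q p' q' c θ := by
  have hg := Adj.unit_of_counit (Adj.rightDagger_counit p p' θ)
  have hh := Adj.leftDagger_counit q q' θ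
  -- `Hom(𝟙, W ⊗ V)` is one-dimensional for simple `V`. Transporting the left mate there shows that
  -- it is proportional to the right mate.
  obtain ⟨c, hc⟩ := exists_smul_unit p (p'.unit ≫ Adj.leftDagger q q' θ ▷ V' ≫ W ◁ inv θ)
  have e : Adj.leftDagger q q' θ = c • Adj.rightDagger p p' θ := by
    apply p'.eq_of_unit_right
    rw [MonoidalLinear.smul_whiskerRight, Linear.comp_smul, hg, ← Linear.smul_comp, ← hc]
    simp [← MonoidalCategory.whiskerLeft_comp]
  have hV' : Simple V' := Simple.of_iso (asIso θ).symm
  have hW' := simple_right_dual p'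
  have hc0 : c ≠ 0 := by
    rintro rfl
    rw [e, zero_smul] at hh
    apply counit_ne_zero q'
    rw [← cancel_epi (W' ◁ θ), ← hh]
    simp
  refine ⟨c⁻¹, (isTwisted_iff _ _ _ _ _ _).2 ?_⟩
  rw [e, smul_smul, inv_mul_cancel₀ hc0, one_smul]

/-- The product of the two loops of a simple object does not depend on the dualities. -/
theorem loop_mul_loop {V W W' : C} [Simple V] {p : Adj V W} {q : Adj W V} {p' : Adj V W'}
    {q' : Adj W' V} {a b a' b' : ℂ} (ha : p.unit ≫ q.counit = a • 𝟙 (𝟙_ C))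
    (hb : q.unit ≫ p.counit = b • 𝟙 (𝟙_ C)) (ha' : p'.unit ≫ q'.counit = a' • 𝟙 (𝟙_ C))
    (hb' : q'.unit ≫ p'.counit = b' • 𝟙 (𝟙_ C)) : a * b = a' * b' := by
  -- The identity is `c`-twisted between the two choices of dualities. One loop then changes by `c`
  -- and the other by its inverse.
  obtain ⟨c, hc⟩ := exists_isTwisted_of_isIso p q p' q' (𝟙 _)
  have h1 := hc.rightTr_comp (𝟙 V)
  have h2 := hc.leftTr_comp (𝟙 V)
  rw [Category.comp_id, Adj.rightTr_id, Adj.rightTr_id, hb, hb', smul_smul] at h1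
  rw [Category.comp_id, Adj.leftTr_id, Adj.leftTr_id, ha, ha', smul_smul] at h2
  rw [smul_id_unit_injective h1, ← smul_id_unit_injective h2]
  ring

theorem leftTr_eq_rightTr {V W : C} [Simple V] {p : Adj V W} {q : Adj W V}
    (h : p.unit ≫ q.counit = q.unit ≫ p.counit) (f : V ⟶ V) :
    Adj.leftTr p q f = Adj.rightTr p q f := by
  obtain ⟨c, rfl⟩ := exists_smul_id f
  simp [Adj.leftTr, Adj.rightTr, h]

theorem doubleDagger_doubleDagger {V W V' W' : C} [Simple V] {p : Adj V W} {q : Adj W V}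
    {p' : Adj V' W'} {q' : Adj W' V'} (h : p.unit ≫ q.counit = q.unit ≫ p.counit)
    (h' : ∀ f, Adj.leftTr p' q' f = Adj.rightTr p' q' f) (a : V ⟶ V') :
    Adj.doubleDagger p q p' q' (Adj.doubleDagger p q p' q' a) = a := by
  have key : ∀ b : V' ⟶ V, Adj.leftTr p q
      ((Adj.doubleDagger p q p' q' (Adj.doubleDagger p q p' q' a) - a) ≫ b) = 0 := by
    intro b
    have h1 := Adj.leftTr_comp_doubleDagger p q p' q' a b
    rw [h', Adj.rightTr_comp_eq p q, ← leftTr_eq_rightTr h] at h1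
    have h2 : ∀ x y : V ⟶ V, Adj.leftTr p q (x - y) = Adj.leftTr p q x - Adj.leftTr p q y := by
      intro x y
      rw [eq_sub_iff_add_eq]
      simp only [Adj.leftTr, ← Preadditive.comp_add, ← Preadditive.add_comp,
        ← MonoidalPreadditive.whiskerLeft_add, sub_add_cancel]
    rw [Preadditive.sub_comp, h2, h1, sub_self]
  -- Nondegeneracy of the trace pairing: a nonzero morphism out of a simple object has a retraction
  -- `r`, and pairing with `r` gives a loop, which is nonzero.
  by_contra hne
  obtain ⟨r, hr⟩ := exists_retraction _ (sub_ne_zero.2 hne)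
  have := key r
  rw [hr, Adj.leftTr_id] at this
  exact unit_comp_counit_ne_zero p q this

namespace SimpleObjects

variable {I : Type w} {S : SimpleObjects C I}

attribute [local instance] SimpleObjects.simple

namespace RootChoice

variable (R : RootChoice S)

/-- The product of the two loops is the paired dimension, which is the square of `R.d i`. If one
loop is the chosen root, so is the other. -/
theorem unit_comp_counit_of_isPartner {i : I} {W : C} {p : Adj (S.X i) W} {q : Adj W (S.X i)}
    (h : R.IsPartner p q) : q.unit ≫ p.counit = R.d i • 𝟙 (𝟙_ C) := by
  obtain ⟨b, hb⟩ := exists_smul_id (q.unit ≫ p.counit)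
  have := loop_mul_loop h hb (unitScalar_spec ((S.rightAdj i).unit ≫ (S.leftAdj i).counit))
    (unitScalar_spec ((S.leftAdj i).unit ≫ (S.rightAdj i).counit))
  rw [hb]
  congr 1
  apply mul_left_cancel₀ (R.ne_zero i)
  rw [this, ← sq, R.sq_eq]
  rfl

theorem isPartner_partner (i : I) : R.IsPartner (S.rightAdj i) (R.partner i) :=
  (R.exists_isPartner i).choose_spec

/-- The identity is twisted by some scalar, and both left loops equal the nonzero number `R.d i`, so
the scalar is `1`. This makes everything independent of the partners chosen. -/
theorem isTwisted_id_of_isPartner {i : I} {W W' : C} {p : Adj (S.X i) W} {q : Adj W (S.X i)}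
    {p' : Adj (S.X i) W'} {q' : Adj W' (S.X i)} (h : R.IsPartner p q) (h' : R.IsPartner p' q') :
    IsTwisted p q p' q' 1 (𝟙 (S.X i)) := by
  obtain ⟨c, hc⟩ := exists_isTwisted_of_isIso p q p' q' (𝟙 _)
  have h2 := hc.leftTr_comp (𝟙 _)
  rw [Category.comp_id, Adj.leftTr_id, Adj.leftTr_id, h, h', smul_smul] at h2
  have := smul_id_unit_injective h2
  have hc1 : c = 1 := by
    apply mul_right_cancel₀ (R.ne_zero i)
    rw [this, one_mul]
  exact hc1 ▸ hc

theorem leftTr_eq_rightTr_partner (i : I) (f : S.X i ⟶ S.X i) :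
    Adj.leftTr (S.rightAdj i) (R.partner i) f = Adj.rightTr (S.rightAdj i) (R.partner i) f :=
  leftTr_eq_rightTr ((R.isPartner_partner i).trans
    (R.unit_comp_counit_of_isPartner (R.isPartner_partner i)).symm) f

theorem T_T (i j k : I) (a : S.X i ⟶ S.X j ⊗ S.X k) : R.T i j k (R.T i j k a) = a :=
  doubleDagger_doubleDagger ((R.isPartner_partner i).trans
    (R.unit_comp_counit_of_isPartner (R.isPartner_partner i)).symm)
    (Adj.leftTr_tensor_eq_rightTr (R.leftTr_eq_rightTr_partner j)
      (R.leftTr_eq_rightTr_partner k)) a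

theorem isTwisted_iff_T {i j k : I} {c : ℂ} {a : S.X i ⟶ S.X j ⊗ S.X k} :
    IsTwisted (S.rightAdj i) (R.partner i) ((S.rightAdj j).tensor (S.rightAdj k))
      ((R.partner k).tensor (R.partner j)) c a ↔ R.T i j k a = c • a :=
  isTwisted_iff_doubleDagger _ _ _ _ _ _

end RootChoice

end SimpleObjects

end Fusion

end EvenHanded

namespace EvenHanded

/-! ### Adjunctions assembled from direct summands -/

section Construction

variable {C : Type u} [Category.{v} C] [MonoidalCategory C]

namespace Adj

@[simp]
theorem rightDagger_id {V W : C} (p : Adj V W) : rightDagger p p (𝟙 V) = 𝟙 W := by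
  rw [rightDagger_eq_iff]; simp

theorem rightDagger_comp {V W V' W' V'' W'' : C} (p : Adj V W) (p' : Adj V' W') (p'' : Adj V'' W'')
    (θ : V ⟶ V') (θ' : V' ⟶ V'') :
    rightDagger p p'' (θ ≫ θ') = rightDagger p' p'' θ' ≫ rightDagger p p' θ := by
  rw [rightDagger_eq_iff, MonoidalCategory.whiskerLeft_comp, Category.assoc, rightDagger_counit,
    whisker_exchange_assoc, rightDagger_counit, comp_whiskerRight, Category.assoc]

theorem rightDagger_zero [Preadditive C] [MonoidalPreadditive C] {V W V' W' : C} (p : Adj V W)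
    (p' : Adj V' W') : rightDagger p p' 0 = 0 := by
  rw [rightDagger_eq_iff]; simp

theorem rightDagger_sum [Preadditive C] [MonoidalPreadditive C] {V W V' W' : C} (p : Adj V W)
    (p' : Adj V' W') {ι : Type*} (s : Finset ι) (θ : ι → (V ⟶ V')) :
    rightDagger p p' (∑ a ∈ s, θ a) = ∑ a ∈ s, rightDagger p p' (θ a) := by
  rw [rightDagger_eq_iff]
  simp only [whiskerLeft_sum, sum_whiskerRight,
    Preadditive.sum_comp, rightDagger_counit]

/-- A general matrix entry of the zigzag of a direct sum. It factors through `ι ≫ π`, so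
off-diagonal entries vanish and diagonal ones reduce to the snake equation of the summand. -/
theorem zigzag_left_of_factor {V W X Y X' Y' : C} (q : Adj Y X) (q' : Adj Y' X') (ι : X ⟶ V)
    (π : V ⟶ X') (u : W ⟶ Y') (v : Y ⟶ W) :
    W ◁ (q.unit ≫ (ι ⊗ₘ v)) ≫ (α_ W V W).inv ≫ ((u ⊗ₘ π) ≫ q'.counit) ▷ W =
      (ρ_ W).hom ≫ u ≫ (𝟙 _ ⊗≫ Y' ◁ q.unit ⊗≫ (Y' ◁ (ι ≫ π) ≫ q'.counit) ▷ Y ⊗≫ 𝟙 _) ≫ v ≫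
        (λ_ W).inv := by
  simp only [MonoidalCategory.tensorHom_def]
  calc
    _ = 𝟙 _ ⊗≫ W ◁ q.unit ⊗≫ W ◁ ι ▷ Y ⊗≫ ((W ⊗ V) ◁ v ≫ (u ▷ V ≫ Y' ◁ π ≫ q'.counit) ▷ W) ⊗≫
        𝟙 _ := by monoidal
    _ = 𝟙 _ ⊗≫ W ◁ q.unit ⊗≫ (W ◁ ι ≫ u ▷ V) ▷ Y ⊗≫ (Y' ◁ π ≫ q'.counit) ▷ Y ⊗≫ v ⊗≫ 𝟙 _ := by
      rw [whisker_exchange]; monoidal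
    _ = 𝟙 _ ⊗≫ (W ◁ q.unit ≫ u ▷ (X ⊗ Y)) ⊗≫ (Y' ◁ (ι ≫ π) ≫ q'.counit) ▷ Y ⊗≫ v ⊗≫ 𝟙 _ := by
      rw [whisker_exchange]; monoidal
    _ = _ := by
      rw [whisker_exchange]; monoidal

theorem zigzag_right_of_factor {V W X Y X' Y' : C} (q : Adj Y X) (q' : Adj Y' X') (ι : X ⟶ V)
    (π : V ⟶ X') (u : W ⟶ Y') (v : Y ⟶ W) :
    (q.unit ≫ (ι ⊗ₘ v)) ▷ V ≫ (α_ V W V).hom ≫ V ◁ ((u ⊗ₘ π) ≫ q'.counit) =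
      (λ_ V).hom ≫ π ≫ (𝟙 _ ⊗≫ q.unit ▷ X' ⊗≫ X ◁ ((v ≫ u) ▷ X' ≫ q'.counit) ⊗≫ 𝟙 _) ≫ ι ≫
        (ρ_ V).inv := by
  simp only [MonoidalCategory.tensorHom_def']
  calc
    _ = 𝟙 _ ⊗≫ q.unit ▷ V ⊗≫ X ◁ v ▷ V ⊗≫ (ι ▷ (W ⊗ V) ≫ V ◁ (W ◁ π ≫ u ▷ X' ≫ q'.counit)) ⊗≫
        𝟙 _ := by monoidal
    _ = 𝟙 _ ⊗≫ q.unit ▷ V ⊗≫ X ◁ (v ▷ V ≫ W ◁ π) ⊗≫ X ◁ (u ▷ X' ≫ q'.counit) ⊗≫ ι ⊗≫ 𝟙 _ := by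
      rw [← whisker_exchange]; monoidal
    _ = 𝟙 _ ⊗≫ (q.unit ▷ V ≫ (X ⊗ Y) ◁ π) ⊗≫ X ◁ ((v ≫ u) ▷ X' ≫ q'.counit) ⊗≫ ι ⊗≫ 𝟙 _ := by
      rw [← whisker_exchange]; monoidal
    _ = _ := by
      rw [← whisker_exchange]; monoidal

/-- The adjunction assembled from adjunctions between the summands of two objects. -/
@[reducible] def ofSummands [Preadditive C] [MonoidalPreadditive C] {V W : C} {n : ℕ}
    {X Y : Fin n → C} (q : ∀ a, Adj (Y a) (X a)) (ι : ∀ a, X a ⟶ V) (π : ∀ a, V ⟶ X a)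
    (u : ∀ a, W ⟶ Y a) (v : ∀ a, Y a ⟶ W) (hιπ : ∀ a, ι a ≫ π a = 𝟙 _)
    (hιπ' : ∀ a b, a ≠ b → ι a ≫ π b = 0) (hvu : ∀ a, v a ≫ u a = 𝟙 _)
    (hvu' : ∀ a b, a ≠ b → v a ≫ u b = 0) (hπι : ∑ a, π a ≫ ι a = 𝟙 V)
    (huv : ∑ a, u a ≫ v a = 𝟙 W) : Adj W V where
  coevaluation' := ∑ a, (q a).unit ≫ (ι a ⊗ₘ v a)
  evaluation' := ∑ a, (u a ⊗ₘ π a) ≫ (q a).counit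
  coevaluation_evaluation' := by
    simp only [whiskerLeft_sum, sum_whiskerRight,
      Preadditive.sum_comp, Preadditive.comp_sum, zigzag_left_of_factor]
    have h : ∀ a b, (ρ_ W).hom ≫ u b ≫ (𝟙 _ ⊗≫ Y b ◁ (q a).unit ⊗≫
        (Y b ◁ (ι a ≫ π b) ≫ (q b).counit) ▷ Y a ⊗≫ 𝟙 _) ≫ v a ≫ (λ_ W).inv =
        if a = b then (ρ_ W).hom ≫ (u a ≫ v a) ≫ (λ_ W).inv else 0 := by
      intro a b
      split_ifs with hab
      · subst hab
        have := (q a).left_zigzag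
        rw [hιπ]
        simp [monoidalComp, reassoc_of% this]
      · rw [hιπ' a b hab]
        simp [monoidalComp]
    simp only [h]
    simp only [Finset.mem_univ, if_true, Finset.sum_ite_eq']
    rw [← Preadditive.comp_sum, ← Preadditive.sum_comp, huv, Category.id_comp]
  evaluation_coevaluation' := by
    simp only [whiskerLeft_sum, sum_whiskerRight,
      Preadditive.sum_comp, Preadditive.comp_sum, zigzag_right_of_factor]
    have h : ∀ a b, (λ_ V).hom ≫ π b ≫ (𝟙 _ ⊗≫ (q a).unit ▷ X b ⊗≫
        X a ◁ ((v a ≫ u b) ▷ X b ≫ (q b).counit) ⊗≫ 𝟙 _) ≫ ι a ≫ (ρ_ V).inv =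
        if a = b then (λ_ V).hom ≫ (π a ≫ ι a) ≫ (ρ_ V).inv else 0 := by
      intro a b
      split_ifs with hab
      · subst hab
        have := (q a).right_zigzag
        rw [hvu]
        simp [monoidalComp, reassoc_of% this]
      · rw [hvu' a b hab]
        simp [monoidalComp]
    simp only [h]
    simp only [Finset.mem_univ, if_true, Finset.sum_ite_eq']
    rw [← Preadditive.comp_sum, ← Preadditive.sum_comp, hπι, Category.id_comp]

end Adj

variable [Preadditive C] [Linear ℂ C]

/-- The right dualities determine the mate `g` of the identity, and `g` together with `q` determines
the counit of the left duality. -/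
theorem IsTwisted.left_unique {V W W' : C} {p : Adj V W} {q : Adj W V} {p' : Adj V W'}
    {q' q'' : Adj W' V} (h : IsTwisted p q p' q' 1 (𝟙 V)) (h' : IsTwisted p q p' q'' 1 (𝟙 V)) :
    q' = q'' := by
  obtain ⟨g, h1, h2⟩ := h
  obtain ⟨g', h1', h2'⟩ := h'
  obtain rfl := p.eq_of_counit_left (h1.trans h1'.symm)
  apply Adj.ext_counit
  simpa using h2.symm.trans h2'

end Construction

/-! ### Extending left dualities from simple objects to an even-handed structure -/

section Fusion

variable {C : Type u} [Category.{v} C] [Abelian C] [Linear ℂ C]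
  [MonoidalCategory C] [MonoidalPreadditive C] [MonoidalLinear ℂ C] [IsFusionCategory C]

attribute [local instance] Abelian.hasFiniteBiproducts
attribute [local instance] IsFusionCategory.finiteDimensional_hom IsFusionCategory.simple_unit

namespace SimpleObjects

variable {I : Type w} (S : SimpleObjects C I)

attribute [local instance] SimpleObjects.simple

/-- A presentation of an object as a direct sum of representative simple objects. -/
structure Decomposition (V : C) where
  /-- The number of summands. -/
  n : ℕ
  /-- The labels of the summands. -/
  label : Fin n → I
  /-- The inclusions. -/
  ι : ∀ a, S.X (label a) ⟶ V
  /-- The projections. -/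
  π : ∀ a, V ⟶ S.X (label a)
  ι_π : ∀ a, ι a ≫ π a = 𝟙 _
  ι_π_of_ne : ∀ a b, a ≠ b → ι a ≫ π b = 0
  sum_π_ι : ∑ a, π a ≫ ι a = 𝟙 V

theorem nonempty_decomposition (V : C) : Nonempty (S.Decomposition V) := by
  obtain ⟨n, T, hT, ⟨e⟩⟩ := IsFusionCategory.semisimple V
  choose l hl using fun a => S.exists_iso (T a) (hT a)
  let φ : ∀ a, T a ≅ S.X (l a) := fun a => (hl a).some
  refine ⟨⟨n, l, fun a => (φ a).inv ≫ biproduct.ι T a ≫ e.inv,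
    fun a => e.hom ≫ biproduct.π T a ≫ (φ a).hom, ?_, ?_, ?_⟩⟩
  · intro a; simp
  · intro a b hab
    simp [biproduct.ι_π_ne_assoc T hab]
  · have h : ∑ a, biproduct.π T a ≫ biproduct.ι T a = 𝟙 (⨁ T) := by
      simp
    have : ∀ a, (e.hom ≫ biproduct.π T a ≫ (φ a).hom) ≫ (φ a).inv ≫ biproduct.ι T a ≫ e.inv =
        e.hom ≫ (biproduct.π T a ≫ biproduct.ι T a) ≫ e.inv := by
      intro a; simp
    simp only [this]
    rw [← Preadditive.comp_sum, ← Preadditive.sum_comp, h]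
    simp

namespace Decomposition

variable {S}

theorem eq_sum {V Z : C} (D : S.Decomposition V) (f : Z ⟶ V) :
    f = ∑ a, (f ≫ D.π a) ≫ D.ι a := by
  simp only [Category.assoc]
  rw [← Preadditive.comp_sum, D.sum_π_ι, Category.comp_id]

end Decomposition

variable {S} (q : ∀ i, Adj (S.X (S.dual i)) (S.X i))

/-- By Schur's lemma `f` is zero or a multiple of an identity, so no condition on `q` arises here.
-/
theorem isTwisted_of_simple {i j : I} (f : S.X i ⟶ S.X j) :
    IsTwisted (S.rightAdj i) (q i) (S.rightAdj j) (q j) 1 f := by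
  by_cases hf : f = 0
  · exact hf ▸ IsTwisted.zero
  · have := (isIso_iff_nonzero f).2 hf
    obtain rfl := S.eq_of_iso i j ⟨asIso f⟩
    obtain ⟨c, rfl⟩ := exists_smul_id f
    exact (IsTwisted.id _ _).smul c

/-- `q'` is the left duality matching the right duality `p` and the left dualities `q` of the
simple objects, if all morphisms from simple objects have equal daggers. -/
def IsLift {V W : C} (p : Adj V W) (q' : Adj W V) : Prop :=
  ∀ i (f : S.X i ⟶ V), IsTwisted (S.rightAdj i) (q i) p q' 1 f

theorem isLift_rightAdj (i : I) : IsLift q (S.rightAdj i) (q i) :=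
  fun _ f => isTwisted_of_simple q f

theorem exists_isLift {V W : C} (p : Adj V W) : ∃ q', IsLift q p q' := by
  obtain ⟨D⟩ := S.nonempty_decomposition V
  let pa := fun a => S.rightAdj (D.label a)
  -- `W` is decomposed by the right mates of the inclusions and projections of `V`. With this choice
  -- the right-hand mate equation holds automatically, and only the left-hand one has to be checked.
  let q' : Adj W V := Adj.ofSummands (fun a => q (D.label a)) D.ι D.π
    (fun a => Adj.rightDagger (pa a) p (D.ι a)) (fun a => Adj.rightDagger p (pa a) (D.π a))
    D.ι_π D.ι_π_of_ne
    (fun a => by rw [← Adj.rightDagger_comp, D.ι_π, Adj.rightDagger_id])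
    (fun a b hab => by
      rw [← Adj.rightDagger_comp, D.ι_π_of_ne _ _ hab.symm, Adj.rightDagger_zero])
    D.sum_π_ι
    (by
      simp only [← Adj.rightDagger_comp]
      rw [← Adj.rightDagger_sum, D.sum_π_ι, Adj.rightDagger_id])
  refine ⟨q', fun i f => ?_⟩
  rw [D.eq_sum f]
  refine IsTwisted.sum _ fun a _ => (isTwisted_of_simple q _).comp_one
    ⟨_, Adj.rightDagger_counit (pa a) p (D.ι a), ?_⟩
  have h : q'.counit =
    ∑ a, (Adj.rightDagger (pa a) p (D.ι a) ⊗ₘ D.π a) ≫ (q (D.label a)).counit := rfl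
  -- Restricting to the summand `a` leaves only the `a`-th term of the assembled counit.
  rw [h, one_smul, Preadditive.comp_sum, Finset.sum_eq_single a]
  · rw [MonoidalCategory.tensorHom_def', ← Category.assoc, ← MonoidalCategory.whiskerLeft_comp_assoc,
      D.ι_π]
    simp
  · intro b _ hb
    rw [MonoidalCategory.tensorHom_def', ← Category.assoc, ← MonoidalCategory.whiskerLeft_comp_assoc,
      D.ι_π_of_ne a b hb.symm]
    simp
  · simp

variable {q}

/-- The left-hand mate equation can be tested after precomposing with the inclusions of the simple
summands of `V`. There it follows by comparing the mates of `D.ι a` and `D.ι a ≫ θ`. -/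
theorem IsLift.isTwisted {V W V' W' : C} {p : Adj V W} {q₁ : Adj W V} {p' : Adj V' W'}
    {q₂ : Adj W' V'} (h : IsLift q p q₁) (h' : IsLift q p' q₂) (θ : V ⟶ V') :
    IsTwisted p q₁ p' q₂ 1 θ := by
  obtain ⟨D⟩ := S.nonempty_decomposition V
  refine ⟨_, Adj.rightDagger_counit p p' θ, ?_⟩
  have key : ∀ a, W' ◁ D.ι a ≫ Adj.rightDagger p p' θ ▷ V ≫ q₁.counit =
      W' ◁ D.ι a ≫ W' ◁ θ ≫ q₂.counit := by
    intro a
    obtain ⟨g, h1, h2⟩ := h _ (D.ι a)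
    obtain ⟨g', h1', h2'⟩ := h' _ (D.ι a ≫ θ)
    obtain rfl := (Adj.rightDagger_eq_iff _ _ _ _).2 h1
    obtain rfl := (Adj.rightDagger_eq_iff _ _ _ _).2 h1'
    rw [one_smul] at h2 h2'
    rw [whisker_exchange_assoc, ← h2, ← comp_whiskerRight_assoc, ← Adj.rightDagger_comp, h2',
      MonoidalCategory.whiskerLeft_comp, Category.assoc]
  rw [one_smul, ← Category.id_comp (Adj.rightDagger p p' θ ▷ V ≫ q₁.counit),
    ← Category.id_comp (W' ◁ θ ≫ q₂.counit), ← MonoidalCategory.whiskerLeft_id, ← D.sum_π_ι]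
  simp only [whiskerLeft_sum, Preadditive.sum_comp,
    MonoidalCategory.whiskerLeft_comp, Category.assoc, key]

theorem IsLift.unique {V W : C} {p : Adj V W} {q₁ q₂ : Adj W V} (h : IsLift q p q₁)
    (h' : IsLift q p q₂) : q₁ = q₂ :=
  (h.isTwisted h (𝟙 V)).left_unique (h.isTwisted h' (𝟙 V))

/-- Decomposing both factors writes `f` as a sum of morphisms `X i ⟶ X j ⊗ X k`, untwisted by `hq`,
each followed by a tensor product of two untwisted inclusions. -/
theorem IsLift.tensor
    (hq : ∀ i j k (a : S.X i ⟶ S.X j ⊗ S.X k), IsTwisted (S.rightAdj i) (q i)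
      ((S.rightAdj j).tensor (S.rightAdj k)) ((q k).tensor (q j)) 1 a)
    {V W V' W' : C} {p : Adj V W} {q₁ : Adj W V} {p' : Adj V' W'}
    {q₂ : Adj W' V'} (h : IsLift q p q₁) (h' : IsLift q p' q₂) :
    IsLift q (p.tensor p') (q₂.tensor q₁) := by
  intro i f
  obtain ⟨D⟩ := S.nonempty_decomposition V
  obtain ⟨D'⟩ := S.nonempty_decomposition V'
  have hf : f = ∑ b, ∑ a, (f ≫ (D.π a ⊗ₘ D'.π b)) ≫ (D.ι a ⊗ₘ D'.ι b) := by
    conv_lhs => rw [← Category.comp_id f, ← id_tensorHom_id, ← D.sum_π_ι, ← D'.sum_π_ι]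
    simp only [tensor_sum, sum_tensor, Preadditive.comp_sum, Category.assoc,
      ← tensorHom_comp_tensorHom]
  rw [hf]
  refine IsTwisted.sum _ fun b _ => IsTwisted.sum _ fun a _ => (hq _ _ _ _).comp_one ?_
  simpa using (h _ (D.ι a)).tensorHom (h' _ (D'.ι b))

/-- An even-handed structure obtained from left dualities of the simple objects for which all
morphisms `X i ⟶ X j ⊗ X k` have equal daggers. -/
noncomputable def evenHandedStructure
    (hq : ∀ i j k (a : S.X i ⟶ S.X j ⊗ S.X k), IsTwisted (S.rightAdj i) (q i)
      ((S.rightAdj j).tensor (S.rightAdj k)) ((q k).tensor (q j)) 1 a) :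
    EvenHandedStructure C :=
  let Ψ : ∀ {V W : C}, Adj V W → Adj W V := fun p => (exists_isLift q p).choose
  have lift : ∀ {V W : C} (p : Adj V W), IsLift q p (Ψ p) := fun p =>
    (exists_isLift q p).choose_spec
  have htensor : ∀ {V V' W W' : C} (p : Adj V V') (p' : Adj W W'),
      Ψ (p.tensor p') = (Ψ p').tensor (Ψ p) := fun p p' =>
    (lift _).unique ((lift p).tensor hq (lift p'))
  have htrivial : Ψ (Adj.trivial C) = Adj.trivial C := by
    obtain ⟨s, hs⟩ := exists_eq_scale (Adj.trivial C) (Ψ (Adj.trivial C))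
    -- The unitor `𝟙 ⊗ 𝟙 ⟶ 𝟙` is 1-twisted by the lifting property. Comparing the scalars `s * s`
    -- and `s` on its two ends makes it `s`-twisted as well, so `s = 1`.
    have h1 := (lift ((Adj.trivial C).tensor (Adj.trivial C))).isTwisted (lift (Adj.trivial C))
      (λ_ (𝟙_ C)).hom
    rw [htensor, hs, Adj.tensor_scale] at h1
    have h2 := (IsTwisted.leftUnitor (Adj.trivial C) (Adj.trivial C)).scale (c' := s) (s * s) s
      (by simp)
    have h3 := h1.unique h2 (by
      intro h
      apply id_nonzero (𝟙_ C)
      rw [← (λ_ (𝟙_ C)).inv_hom_id, h, comp_zero])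
    have : s = 1 := Units.ext (by simpa using h3.symm)
    rw [hs, this, Adj.scale_one]
  { Ψ := Ψ
    Ψ_Ψ := fun {V W} p => by
      -- The right mate of the unit of `Ψ p` is the counit of `p`; its left mate is the counit of `Ψ
      -- (Ψ p)`. Even-handedness equates them, and a counit determines its adjunction.
      obtain ⟨g, h1, h2⟩ := (lift (Adj.trivial C)).isTwisted (lift (p.tensor (Ψ p))) (Ψ p).unit
      rw [htrivial, htensor, one_smul, ← IsTwisted.unit_zigzag_left] at h2
      rw [← IsTwisted.unit_zigzag_right] at h1
      have e1 := (Adj.trivial C).eq_of_counit_left h1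
      have e2 := (Adj.trivial C).eq_of_counit_right h2
      exact Adj.ext_counit (e2.symm.trans e1)
    Ψ_tensor := htensor
    Ψ_trivial := htrivial
    even_handed := fun p p' θ => by
      simpa using (isTwisted_iff _ _ _ _ _ _).1 ((lift p).isTwisted (lift p') θ) }

theorem isLift_evenHandedStructure
    (hq : ∀ i j k (a : S.X i ⟶ S.X j ⊗ S.X k), IsTwisted (S.rightAdj i) (q i)
      ((S.rightAdj j).tensor (S.rightAdj k)) ((q k).tensor (q j)) 1 a) {V W : C} (p : Adj V W) :
    IsLift q p ((evenHandedStructure hq).Ψ p) :=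
  (exists_isLift q p).choose_spec

end SimpleObjects

end Fusion

end EvenHanded

namespace EvenHanded

/-! ### Even-handed structures as twisted automorphisms; the spherical condition -/

section Classification

variable {C : Type u} [Category.{v} C] [Abelian C] [Linear ℂ C]
  [MonoidalCategory C] [MonoidalPreadditive C] [MonoidalLinear ℂ C] [IsFusionCategory C]

attribute [local instance] IsFusionCategory.finiteDimensional_hom IsFusionCategory.simple_unit
attribute [local instance] SimpleObjects.simple

variable {I : Type w} {S : SimpleObjects C I} (R : S.RootChoice)

theorem scale_injective {V W : C} [Simple V] (p : Adj V W) {s t : ℂˣ}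
    (h : p.scale s = p.scale t) : s = t := by
  have h' : (s : ℂ) • p.counit = (t : ℂ) • p.counit := congrArg Adj.counit h
  have h0 : ((s : ℂ) - t) • p.counit = 0 := by rw [sub_smul, h', sub_self]
  exact Units.ext (sub_eq_zero.1 ((smul_eq_zero.1 h0).resolve_right (counit_ne_zero p)))

namespace EvenHandedStructure

variable (E : EvenHandedStructure C)

theorem isTwisted {V W V' W' : C} (p : Adj V W) (p' : Adj V' W') (θ : V ⟶ V') :
    IsTwisted p (E.Ψ p) p' (E.Ψ p') 1 θ := by
  rw [isTwisted_iff, one_smul, E.even_handed]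

theorem exists_scalar (i : I) : ∃ t : ℂˣ, E.Ψ (S.rightAdj i) = (R.partner i).scale t :=
  exists_eq_scale _ _

/-- The scalar comparing an even-handed structure with the partners of the simple object `X i`. -/
noncomputable def scalar (i : I) : ℂˣ := (E.exists_scalar R i).choose

theorem Ψ_rightAdj (i : I) : E.Ψ (S.rightAdj i) = (R.partner i).scale (E.scalar R i) :=
  (E.exists_scalar R i).choose_spec

theorem Ψ_of_isPartner {i : I} {W : C} {p : Adj (S.X i) W} {q : Adj W (S.X i)}
    (h : R.IsPartner p q) : E.Ψ p = q.scale (E.scalar R i) := by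
  have h1 := E.isTwisted (S.rightAdj i) p (𝟙 _)
  have h2 := (R.isTwisted_id_of_isPartner (R.isPartner_partner i) h).scale (E.scalar R i)
    (E.scalar R i) (c' := 1) (by ring)
  rw [← E.Ψ_rightAdj] at h2
  exact h1.left_unique h2

/-- For the dualities given by `E` the morphism is untwisted. Rescaling these back to the partners
contributes the three scalars. -/
theorem isTwisted_partner {i j k : I} (a : S.X i ⟶ S.X j ⊗ S.X k) :
    IsTwisted (S.rightAdj i) (R.partner i) ((S.rightAdj j).tensor (S.rightAdj k))
      ((R.partner k).tensor (R.partner j))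
      (E.scalar R j * E.scalar R k * ((E.scalar R i)⁻¹ : ℂˣ)) a := by
  have h := E.isTwisted (S.rightAdj i) ((S.rightAdj j).tensor (S.rightAdj k)) a
  rw [E.Ψ_tensor, E.Ψ_rightAdj R, E.Ψ_rightAdj R, E.Ψ_rightAdj R, Adj.tensor_scale] at h
  have h' := h.scale (E.scalar R i)⁻¹ (E.scalar R k * E.scalar R j)⁻¹
    (c' := E.scalar R j * E.scalar R k * ((E.scalar R i)⁻¹ : ℂˣ)) (by
      push_cast
      have h1 := (E.scalar R j).ne_zero
      have h2 := (E.scalar R k).ne_zero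
      field_simp)
  simpa only [Adj.scale_scale, mul_inv_cancel, Adj.scale_one] using h'

theorem T_eq_smul (i j k : I) : R.T i j k =
    (E.scalar R j * E.scalar R k * ((E.scalar R i)⁻¹ : ℂˣ) : ℂ) • LinearMap.id := by
  ext a
  exact R.isTwisted_iff_T.1 (E.isTwisted_partner R a)

theorem T_eq_id_or_neg_id (E : EvenHandedStructure C) (i j k : I) : R.T i j k = LinearMap.id ∨ R.T i j k = -LinearMap.id := by
  have h := E.T_eq_smul R i j k
  generalize (E.scalar R j * E.scalar R k * ((E.scalar R i)⁻¹ : ℂˣ) : ℂ) = c at h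
  -- On a zero Hom-space every operator is the identity; otherwise the scalar `c` is pinned down by
  -- `c * c = 1`.
  by_cases h0 : ∀ a : S.X i ⟶ S.X j ⊗ S.X k, a = 0
  · left
    ext a
    rw [h0 a, map_zero, map_zero]
  · push Not at h0
    obtain ⟨a, ha⟩ := h0
    have h1 := R.T_T i j k a
    simp only [h, LinearMap.smul_apply, LinearMap.id_apply, smul_smul] at h1
    have h2 : (c * c - 1) • a = 0 := by rw [sub_smul, h1, one_smul, sub_self]
    have h3 := sub_eq_zero.1 ((smul_eq_zero.1 h2).resolve_right ha)
    rcases mul_self_eq_one_iff.1 h3 with rfl | rfl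
    · left; rw [h, one_smul]
    · right; rw [h, neg_smul, one_smul]

theorem rightTrace_comp {V W V' W' : C} (p : Adj V W) (p' : Adj V' W') (θ : V ⟶ V') (b : V' ⟶ V) :
    E.rightTrace p' (b ≫ θ) = E.rightTrace p (θ ≫ b) :=
  ((E.isTwisted p p' θ).rightTr_comp b).trans (one_smul _ _)

theorem leftTrace_comp {V W V' W' : C} (p : Adj V W) (p' : Adj V' W') (θ : V ⟶ V') (b : V' ⟶ V) :
    E.leftTrace p' (b ≫ θ) = E.leftTrace p (θ ≫ b) :=
  (one_smul ℂ _).symm.trans ((E.isTwisted p p' θ).leftTr_comp b)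

/-- Both traces are linear and cyclic, so semisimplicity reduces sphericality to the two loops of
each simple object. These are `R.d i` times the scalar and times its inverse. -/
theorem isSpherical_iff : E.IsSpherical ↔ ∀ i, E.scalar R i * E.scalar R i = 1 := by
  have key : ∀ i, (E.Ψ (S.rightAdj i)).unit ≫ (S.rightAdj i).counit =
      ((((E.scalar R i)⁻¹ : ℂˣ) : ℂ) * R.d i) • 𝟙 (𝟙_ C) := by
    intro i
    rw [E.Ψ_rightAdj R, Adj.scale_unit, Linear.smul_comp,
      R.unit_comp_counit_of_isPartner (R.isPartner_partner i), smul_smul]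
  have key' : ∀ i, (S.rightAdj i).unit ≫ (E.Ψ (S.rightAdj i)).counit =
      ((E.scalar R i : ℂ) * R.d i) • 𝟙 (𝟙_ C) := by
    intro i
    rw [E.Ψ_rightAdj R, Adj.scale_counit, Linear.comp_smul,
      show (S.rightAdj i).unit ≫ (R.partner i).counit = _ from R.isPartner_partner i, smul_smul]
  constructor
  · intro h i
    have h1 := h _ _ (S.rightAdj i) (𝟙 _)
    simp only [rightTrace, leftTrace, id_whiskerRight, whiskerLeft_id, Category.id_comp, key,
      key'] at h1
    have h2 := mul_right_cancel₀ (R.ne_zero i) (smul_id_unit_injective h1)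
    exact mul_eq_one_iff_eq_inv.2 (Units.ext h2.symm)
  · intro h V W p f
    obtain ⟨D⟩ := S.nonempty_decomposition V
    have h1 : ∀ a, E.rightTrace p ((f ≫ D.π a) ≫ D.ι a) = E.leftTrace p ((f ≫ D.π a) ≫ D.ι a) := by
      intro a
      rw [E.rightTrace_comp (S.rightAdj (D.label a)), E.leftTrace_comp (S.rightAdj (D.label a))]
      refine (leftTr_eq_rightTr ?_ _).symm
      rw [key, key', ← mul_eq_one_iff_eq_inv.1 (h (D.label a))]
    rw [D.eq_sum f]
    simp only [rightTrace, leftTrace, whiskerLeft_sum, sum_whiskerRight, Preadditive.sum_comp,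
      Preadditive.comp_sum] at h1 ⊢
    exact Finset.sum_congr rfl fun a _ => h1 a

end EvenHandedStructure

namespace SimpleObjects

theorem appears_of_ne_zero {i j k : I} {a : S.X i ⟶ S.X j ⊗ S.X k} (ha : a ≠ 0) :
    S.fusionRules.N i j k ≠ 0 := by
  have : Nontrivial (S.X i ⟶ S.X j ⊗ S.X k) := ⟨a, 0, ha⟩
  exact (Module.finrank_pos (R := ℂ) (M := S.X i ⟶ S.X j ⊗ S.X k)).ne'

theorem exists_ne_zero {i j k : I} (h : S.fusionRules.N i j k ≠ 0) :
    ∃ a : S.X i ⟶ S.X j ⊗ S.X k, a ≠ 0 := by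
  by_contra! h0
  have : Subsingleton (S.X i ⟶ S.X j ⊗ S.X k) := ⟨fun a b => (h0 a).trans (h0 b).symm⟩
  exact h (Module.finrank_zero_of_subsingleton (R := ℂ) (M := S.X i ⟶ S.X j ⊗ S.X k))

theorem signs_injective {x y : ℤˣ} (h : ((x : ℤ) : ℂ) = ((y : ℤ) : ℂ)) : x = y :=
  Units.ext (Int.cast_injective h)

variable {R} {ε : S.fusionRules.Triple → ℤˣ}

theorem eq_of_isTwisted
    (hT : ∀ s : S.fusionRules.Triple, R.T s.i s.j s.k = ((ε s : ℤ) : ℂ) • LinearMap.id)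
    {i j k : I} {a : S.X i ⟶ S.X j ⊗ S.X k} (ha : a ≠ 0) (h : S.fusionRules.N i j k ≠ 0) {c : ℂ}
    (hc : IsTwisted (S.rightAdj i) (R.partner i) ((S.rightAdj j).tensor (S.rightAdj k))
      ((R.partner k).tensor (R.partner j)) c a) : c = ((ε ⟨i, j, k, h⟩ : ℤ) : ℂ) :=
  hc.unique (R.isTwisted_iff_T.2 (by rw [hT ⟨i, j, k, h⟩]; rfl)) ha

/-- Even-handed structures correspond to twisted monoidal natural transformations of the
identity. -/
noncomputable def equivTwistedAut
    (hT : ∀ s : S.fusionRules.Triple, R.T s.i s.j s.k = ((ε s : ℤ) : ℂ) • LinearMap.id) :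
    EvenHandedStructure C ≃ S.TwistedAut ε :=
  have hq : ∀ t : S.TwistedAut ε, ∀ i j k (a : S.X i ⟶ S.X j ⊗ S.X k),
      IsTwisted (S.rightAdj i) ((R.partner i).scale (t.1 i))
        ((S.rightAdj j).tensor (S.rightAdj k))
        (((R.partner k).scale (t.1 k)).tensor ((R.partner j).scale (t.1 j))) 1 a := by
    intro t i j k a
    by_cases ha : a = 0
    · exact ha ▸ IsTwisted.zero
    · have h := appears_of_ne_zero ha
      rw [Adj.tensor_scale]
      have h' : R.T i j k a = ((ε ⟨i, j, k, h⟩ : ℤ) : ℂ) • a := by rw [hT ⟨i, j, k, h⟩]; rfl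
      refine (R.isTwisted_iff_T.2 h').scale _ _ ?_
      have := t.2 ⟨i, j, k, h⟩
      push_cast
      rw [one_mul, mul_comm, ← this, mul_comm]
  { toFun E := ⟨E.scalar R, fun s => by
      obtain ⟨a, ha⟩ := exists_ne_zero s.appears
      have := eq_of_isTwisted hT ha s.appears (E.isTwisted_partner R a)
      rw [← this]
      simp⟩
    invFun t := evenHandedStructure (hq t)
    left_inv E := by
      apply EvenHandedStructure.ext
      funext V W p
      -- `E` itself supplies a lift of its own values on the simple objects, and lifts are unique.
      refine (isLift_evenHandedStructure (hq _) p).unique fun i f => ?_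
      have h := E.isTwisted (S.rightAdj i) p f
      rwa [E.Ψ_rightAdj R] at h
    right_inv t := by
      apply Subtype.ext
      funext i
      have h := (isLift_evenHandedStructure (hq t) (S.rightAdj i)).unique (isLift_rightAdj _ i)
      rw [EvenHandedStructure.Ψ_rightAdj R] at h
      exact scale_injective _ h }

@[simp]
theorem equivTwistedAut_apply
    (hT : ∀ s : S.fusionRules.Triple, R.T s.i s.j s.k = ((ε s : ℤ) : ℂ) • LinearMap.id)
    (E : EvenHandedStructure C) (i : I) : (equivTwistedAut hT E).1 i = E.scalar R i := rfl

/-! ### Symmetries of `ε` and its class in pivotal cohomology -/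

namespace RootChoice

variable (R)

/-- Both loops of a partner pair equal the root, and the root is the same for `i` and its dual; so
swapping the two dualities gives partners for the dual label. The dualities inherited from `X i` may
therefore replace the chosen ones on the dual object. -/
theorem isPartner_dual (i : I) : R.IsPartner (i := S.dual i) (R.partner i) (S.rightAdj i) := by
  rw [IsPartner, R.unit_comp_counit_of_isPartner (R.isPartner_partner i), R.d_dual]

theorem isTwisted_id_dual (i : I) : IsTwisted (R.partner i) (S.rightAdj i)
    (S.rightAdj (S.dual i)) (R.partner (S.dual i)) 1 (𝟙 _) :=
  R.isTwisted_id_of_isPartner (R.isPartner_dual i) (R.isPartner_partner _)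

theorem isTwisted_id_dual' (i : I) : IsTwisted (S.rightAdj (S.dual i)) (R.partner (S.dual i))
    (R.partner i) (S.rightAdj i) 1 (𝟙 _) :=
  R.isTwisted_id_of_isPartner (R.isPartner_partner _) (R.isPartner_dual i)

/-- The loop of the trivial adjunction is `1`, so it agrees with the partner loop on `X 0` precisely
because the chosen root there is `1`. -/
theorem isTwisted_unitIndex (hd : R.d S.unitIndex = 1) (θ : S.X S.unitIndex ⟶ 𝟙_ C) [IsIso θ] :
    IsTwisted (S.rightAdj S.unitIndex) (R.partner S.unitIndex) (Adj.trivial C) (Adj.trivial C)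
      1 θ := by
  obtain ⟨c, hc⟩ := exists_isTwisted_of_isIso (S.rightAdj S.unitIndex) (R.partner S.unitIndex)
    (Adj.trivial C) (Adj.trivial C) θ
  have h := hc.leftTr_comp (inv θ)
  rw [IsIso.inv_hom_id, IsIso.hom_inv_id, Adj.leftTr_id, Adj.leftTr_id, R.isPartner_partner,
    hd, Adj.trivial_unit, Adj.trivial_counit, Iso.inv_hom_id] at h
  exact smul_id_unit_injective h ▸ hc

/-- There is a nonzero untwisted morphism from the unit to the product of `X i` and its dual. -/
theorem exists_isTwisted_one (hd : R.d S.unitIndex = 1) (i : I) :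
    ∃ a : S.X S.unitIndex ⟶ S.X i ⊗ S.X (S.dual i), a ≠ 0 ∧
      IsTwisted (S.rightAdj S.unitIndex) (R.partner S.unitIndex)
        ((S.rightAdj i).tensor (S.rightAdj (S.dual i)))
        ((R.partner (S.dual i)).tensor (R.partner i)) 1 a := by
  obtain ⟨e⟩ : Nonempty (𝟙_ C ≅ S.X S.unitIndex) := S.exists_unitIndex.choose_spec
  refine ⟨e.inv ≫ (R.partner i).unit ≫ S.X i ◁ 𝟙 _, ?_, ?_⟩
  · intro h
    apply unit_ne_zero (R.partner i)
    simpa using h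
  · exact (R.isTwisted_unitIndex hd e.inv).comp_one
      ((IsTwisted.unit (S.rightAdj i) (R.partner i)).comp_one
        ((R.isTwisted_id_dual i).whiskerLeft _ _))

end RootChoice

theorem mem_pivotalSymbols
    (hT : ∀ s : S.fusionRules.Triple, R.T s.i s.j s.k = ((ε s : ℤ) : ℂ) • LinearMap.id)
    (hd : R.d S.unitIndex = 1) : ε ∈ S.fusionRules.pivotalSymbols := by
  have hεT : ∀ {i j k : I} (h : S.fusionRules.N i j k ≠ 0) (a : S.X i ⟶ S.X j ⊗ S.X k),
      IsTwisted (S.rightAdj i) (R.partner i) ((S.rightAdj j).tensor (S.rightAdj k))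
        ((R.partner k).tensor (R.partner j)) ((ε ⟨i, j, k, h⟩ : ℤ) : ℂ) a := fun h a =>
    R.isTwisted_iff_T.2 (by rw [hT ⟨_, _, _, h⟩]; rfl)
  refine ⟨fun i j k h h' => ?_, fun i j k h h' => ?_, fun i h => ?_⟩
  · change S.fusionRules.N (S.dual k) (S.dual i) j ≠ 0 at h'
    obtain ⟨a, ha⟩ := exists_ne_zero h
    -- Rotate `a`: bend the strand `k` down to get `c`, then the strand `i` up to get `b`. Both
    -- operations are bijective on Hom-spaces and use only untwisted pieces besides `a`, so `b` is
    -- nonzero with the same scalar.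
    let c : S.X i ⊗ S.X (S.dual k) ⟶ S.X j :=
      a ▷ S.X (S.dual k) ≫ (α_ _ _ _).hom ≫ S.X j ◁ (S.rightAdj k).counit ≫ (ρ_ _).hom
    let b : S.X (S.dual k) ⟶ S.X (S.dual i) ⊗ S.X j :=
      (λ_ _).inv ≫ (S.rightAdj i).unit ▷ S.X (S.dual k) ≫ (α_ _ _ _).hom ≫ S.X (S.dual i) ◁ c
    have hc : c ≠ 0 := by
      intro hc
      let _ : ExactPairing (S.X (S.dual k)) (S.X k) := S.rightAdj k
      apply ha
      apply (tensorRightHomEquiv (S.X i) (S.X (S.dual k)) (S.X k) (S.X j)).symm.injective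
      refine Eq.trans ?_ (hc.trans ?_)
      · rfl
      · simp [tensorRightHomEquiv]
    have hb : b ≠ 0 := by
      intro hb
      let _ : ExactPairing (S.X (S.dual i)) (S.X i) := S.rightAdj i
      apply hc
      apply (tensorLeftHomEquiv (S.X (S.dual k)) (S.X (S.dual i)) (S.X i) (S.X j)).injective
      refine Eq.trans ?_ (hb.trans ?_)
      · rfl
      · simp [tensorLeftHomEquiv]
    have hc' : IsTwisted ((S.rightAdj i).tensor (R.partner k)) ((S.rightAdj k).tensor (R.partner i))
        (S.rightAdj j) (R.partner j) ((ε ⟨i, j, k, h⟩ : ℤ) : ℂ) c :=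
      ((hεT h a).whiskerRight (R.partner k) (S.rightAdj k)).comp_one
        ((IsTwisted.associator _ _ _ _ _ _).one_comp
          (((IsTwisted.counit (S.rightAdj k) (R.partner k)).whiskerLeft _ _).one_comp
            (IsTwisted.rightUnitor _ _)))
    have hb' : IsTwisted (R.partner k) (S.rightAdj k) ((R.partner i).tensor (S.rightAdj j))
        ((R.partner j).tensor (S.rightAdj i)) ((ε ⟨i, j, k, h⟩ : ℤ) : ℂ) b :=
      (IsTwisted.leftUnitor_inv _ _).one_comp
        (((IsTwisted.unit (R.partner i) (S.rightAdj i)).whiskerRight _ _).one_comp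
          ((IsTwisted.associator _ _ _ _ _ _).one_comp (hc'.whiskerLeft _ _)))
    have hb'' := (R.isTwisted_id_dual' k).one_comp (hb'.comp_one
      ((R.isTwisted_id_dual i).whiskerRight (S.rightAdj j) (R.partner j)))
    simp only [id_whiskerRight, Category.comp_id, Category.id_comp] at hb''
    exact signs_injective (eq_of_isTwisted hT hb h' hb'')
  · change S.fusionRules.N (S.dual i) (S.dual k) (S.dual j) ≠ 0 at h'
    change ε ⟨i, j, k, h⟩ = ε ⟨S.dual i, S.dual k, S.dual j, h'⟩
    obtain ⟨a, ha⟩ := exists_ne_zero h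
    have hm := (hεT h a).mate
    have hm0 : Adj.rightDagger (S.rightAdj i) ((S.rightAdj j).tensor (S.rightAdj k)) a ≠ 0 := by
      intro h0
      apply ha
      apply Adj.eq_of_rightDagger_eq (S.rightAdj i) ((S.rightAdj j).tensor (S.rightAdj k))
      rw [h0, Adj.rightDagger_zero]
    -- The mate of `a` carries the scalar of `a`, and its section `b` carries the symbol of the dual
    -- triple. Their composite is an identity, which is 1-twisted, so the two signs multiply to `1`.
    obtain ⟨b, hb⟩ := exists_section _ hm0
    have h1 := (R.isTwisted_id_dual k).tensorHom (R.isTwisted_id_dual j)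
    have h1' := (R.isTwisted_id_dual' k).tensorHom (R.isTwisted_id_dual' j)
    rw [id_tensorHom_id, mul_one] at h1 h1'
    have h2 := ((hεT h' b).comp_one h1').comp (hm.comp_one (R.isTwisted_id_dual i))
    rw [Category.comp_id, Category.comp_id, hb] at h2
    have h3 := h2.unique (IsTwisted.id _ _) (id_nonzero _)
    have h4 : ε ⟨S.dual i, S.dual k, S.dual j, h'⟩ * ε ⟨i, j, k, h⟩ = 1 := by
      apply signs_injective
      push_cast
      exact h3
    rw [mul_eq_one_iff_eq_inv, Int.units_inv_eq_self] at h4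
    exact h4.symm
  · obtain ⟨a, ha, ha'⟩ := R.exists_isTwisted_one hd i
    refine signs_injective ((eq_of_isTwisted hT ha h ha').symm.trans ?_)
    simp

theorem scalar_unitIndex (hd : R.d S.unitIndex = 1) (E : EvenHandedStructure C) :
    E.scalar R S.unitIndex = 1 := by
  obtain ⟨e⟩ : Nonempty (𝟙_ C ≅ S.X S.unitIndex) := S.exists_unitIndex.choose_spec
  have h1 := E.isTwisted (S.rightAdj S.unitIndex) (Adj.trivial C) e.inv
  rw [E.Ψ_rightAdj R, E.Ψ_trivial] at h1
  have h2 := (R.isTwisted_unitIndex hd e.inv).scale (E.scalar R S.unitIndex) 1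
    (c' := E.scalar R S.unitIndex) (by simp)
  rw [Adj.scale_one] at h2
  have h3 : e.inv ≠ 0 := by
    intro h
    apply id_nonzero (𝟙_ C)
    rw [← e.hom_inv_id, h, comp_zero]
  exact Units.ext (h2.unique h1 h3)

theorem exists_isSpherical_iff
    (hT : ∀ s : S.fusionRules.Triple, R.T s.i s.j s.k = ((ε s : ℤ) : ℂ) • LinearMap.id)
    (hd : R.d S.unitIndex = 1) (hε : ε ∈ S.fusionRules.pivotalSymbols) :
    (∃ E : EvenHandedStructure C, E.IsSpherical) ↔
      (QuotientGroup.mk ⟨ε, hε⟩ : S.fusionRules.HPiv) = 1 := by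
  rw [QuotientGroup.eq_one_iff]
  constructor
  · rintro ⟨E, hE⟩
    rw [E.isSpherical_iff R] at hE
    have hf : ∀ i, ∃ f : ℤˣ, ((f : ℤ) : ℂ) = E.scalar R i := by
      intro i
      have h : (E.scalar R i : ℂ) * E.scalar R i = 1 := by
        rw [← Units.val_mul, hE i, Units.val_one]
      rcases mul_self_eq_one_iff.1 h with h | h
      · exact ⟨1, by simp [h]⟩
      · exact ⟨-1, by simp [h]⟩
    choose f hf using hf
    have hmul : ∀ s : S.fusionRules.Triple, f s.j * f s.k = ε s * f s.i := by
      intro s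
      apply signs_injective
      have := (equivTwistedAut hT E).2 s
      simp only [equivTwistedAut_apply, ← hf] at this
      exact_mod_cast this
    have h0 : f S.unitIndex = 1 := by
      apply signs_injective
      rw [hf, scalar_unitIndex hd]
      simp
    refine ⟨f, h0, fun i => ?_, fun s => ?_⟩
    -- The relation for `X 0` inside the product of `X i` with its dual reads `f i * f (S.dual i) =
    -- 1`, which for signs means equality.
    · obtain ⟨a, ha, -⟩ := R.exists_isTwisted_one hd i
      have h := hmul ⟨S.unitIndex, i, S.dual i, appears_of_ne_zero ha⟩
      have h1 := hε.2.2 i (appears_of_ne_zero ha)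
      change f i * f (S.dual i) = ε ⟨S.unitIndex, i, S.dual i, _⟩ * f S.unitIndex at h
      change ε ⟨S.unitIndex, i, S.dual i, _⟩ = 1 at h1
      rw [h1, h0, mul_one, mul_eq_one_iff_eq_inv, Int.units_inv_eq_self] at h
      exact h.symm
    · change ε s = _
      rw [mul_assoc, hmul, mul_comm (ε s), ← mul_assoc, Int.units_mul_self, one_mul]
  · rintro ⟨f, -, -, hf⟩
    -- The trivialising signs, viewed in `ℂ`, are the twisted automorphism: `ε = f i * f j * f k` is
    -- equivalent to `f j * f k = ε * f i` since signs square to `1`.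
    let t : S.TwistedAut ε := ⟨fun i => Units.map (Int.castRingHom ℂ).toMonoidHom (f i), fun s => by
      have h : f s.j * f s.k = ε s * f s.i := by
        have h1 : ε s = _ := hf s
        rw [h1, mul_comm _ (f s.i), mul_assoc (f s.i), ← mul_assoc, Int.units_mul_self, one_mul]
      have h' : (f s.j : ℤ) * (f s.k : ℤ) = ε s * f s.i := by exact_mod_cast congrArg Units.val h
      simp only [Units.coe_map, MonoidHom.coe_coe, RingHom.toMonoidHom_eq_coe, eq_intCast]
      exact_mod_cast h'⟩
    refine ⟨(equivTwistedAut hT).symm t, ?_⟩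
    rw [EvenHandedStructure.isSpherical_iff R]
    intro i
    rw [← equivTwistedAut_apply hT, Equiv.apply_symm_apply]
    change Units.map _ (f i) * Units.map _ (f i) = 1
    rw [← map_mul, Int.units_mul_self, map_one]

end SimpleObjects

end Classification

end EvenHanded

/-! ### The classification theorem -/

open EvenHanded in
theorem mainTheorem3 {C : Type u} [Category.{v} C] [Abelian C] [Linear ℂ C]
    [MonoidalCategory C] [MonoidalPreadditive C] [MonoidalLinear ℂ C] [IsFusionCategory C]
    {I : Type w} (S : SimpleObjects C I) (R : S.RootChoice) :
    (∀ i j k, R.T i j k ∘ₗ R.T i j k = LinearMap.id) ∧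
    ((∃ i j k, R.T i j k ≠ LinearMap.id ∧ R.T i j k ≠ -LinearMap.id) →
      IsEmpty (EvenHandedStructure C)) ∧
    (∀ ε : S.fusionRules.Triple → ℤˣ,
      (∀ s : S.fusionRules.Triple,
        R.T s.i s.j s.k = ((ε s : ℤ) : ℂ) • LinearMap.id) →
      (∃ Φ : EvenHandedStructure C ≃ S.TwistedAut ε,
        ∀ (E : EvenHandedStructure C) (i : I) (W : C) (p : Adj (S.X i) W) (q : Adj W (S.X i)),
          R.IsPartner p q →
            (E.Ψ p).unit = ((Φ E).1 i : ℂ)⁻¹ • q.unit ∧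
            (E.Ψ p).counit = ((Φ E).1 i : ℂ) • q.counit) ∧
      (R.d S.unitIndex = 1 →
        ∃ hε : ε ∈ S.fusionRules.pivotalSymbols,
          (∃ E : EvenHandedStructure C, E.IsSpherical) ↔
            (QuotientGroup.mk ⟨ε, hε⟩ : S.fusionRules.HPiv) = 1)) := by
  refine ⟨fun i j k => LinearMap.ext (R.T_T i j k), ?_, fun ε hT => ⟨?_, fun hd => ?_⟩⟩
  · rintro ⟨i, j, k, h1, h2⟩
    exact ⟨fun E => (EvenHandedStructure.T_eq_id_or_neg_id R E i j k).elim h1 h2⟩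
  · refine ⟨SimpleObjects.equivTwistedAut hT, fun E i W p q h => ?_⟩
    rw [E.Ψ_of_isPartner R h, Adj.scale_unit, Adj.scale_counit, Units.val_inv_eq_inv_val]
    exact ⟨rfl, rfl⟩
  · exact ⟨SimpleObjects.mem_pivotalSymbols hT hd,
      SimpleObjects.exists_isSpherical_iff hT hd _⟩
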